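/- Let $a<b$ be real numbers, let $E$ and $F$ be real Banach spaces, $U\subseteq E$ an open subset, and $k\in\{0,1,2,\dots\}\cup\{\infty\}$. \emph{Differentiability.} A map $f\colon V\to Y$ from an open subset $V$ of a Banach space $X$ to a Banach space $Y$ is called $C^k$ (in the sense of Bastiani) if it is continuous, the iterated directional derivatives $d^jf(x,y_1,\dots,y_j):=(D_{y_j}\cdots D_{y_1}f)(x)$ exist for all integers $0\le j\le k$, $x\in V$, $y_1,\dots,y_j\in X$, and all the maps $d^jf\colon V\times X^j\to Y$ are continuous. If $V\subseteq X$ is not open but has dense interior $V^0$ and each point of $V$ has a convex neighbourhood in $V$ (e.g. $V=[a,b]\times U\subseteq\mathbb R\times E$), then $f$ is called $C^k$ if $f$ is continuous, $f|_{V^0}$ is $C^k$, and each $d^j(f|_{V^0})$ with $j\le k$ has a continuous extension $V\times X^j\to Y$. Smooth means $C^\infty$. \emph{BV-functions.} $\mathrm{BV}([a,b],E)$ is the space of all functions $f\colon[a,b]\to E$ for which there is a non-atomic $E$-valued vector measure $\mu$ on the Borel $\sigma$-algebra of $[a,b]$ of the form $\mu=\rho\,\mathrm d\nu$ (with $\nu$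 a finite positive measure and $\rho$ Bochner integrable with respect to $\nu$) such that $f(x)=f(a)+\mu([a,x])$ for all $x\in[a,b]$. Here $\mu=:f'$ is determined by $f$, and the space is given the norm $\|f\|_{BV}=\|f(a)\|_E+\mathrm{Var}(f')([a,b])$, where $\mathrm{Var}$ denotes the variation. Let $\mathrm{BV}([a,b],U):=\{f\in\mathrm{BV}([a,b],E): f([a,b])\subseteq U\}$. \emph{Statement.} The set $\mathrm{BV}([a,b],U)$ is open in $\mathrm{BV}([a,b],E)$. If $\varphi\colon[a,b]\times U\to F$ is a $C^{k+2}$-map, then $\varphi\circ(\mathrm{id}_{[a,b]},f)\in \mathrm{BV}([a,b],F)$ for each $f\in\mathrm{BV}([a,b],U)$, and the map \[ \varphi_\star\colon \mathrm{BV}([a,b],U)\to\mathrm{BV}([a,b],F),\qquad f\mapsto\varphi\circ(\mathrm{id}_{[a,b]},f) \] is $C^k$. In particular, $\varphi_\star$ is smooth whenever $\varphi$ is smooth. -/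

import Mathlib

open MeasureTheory Set Topology

/-! ### Differential calculus in the sense of Bastiani (Keller's `C^k_c`-theory) -/

section Bastiani

variable {E F : Type*} [NormedAddCommGroup E] [NormedSpace ℝ E]
  [NormedAddCommGroup F] [NormedSpace ℝ F]

/-- The iterated directional derivatives
`d^j f (x, y₁, …, y_j) = (D_{y_j} ⋯ D_{y_1} f)(x)` of a map `f`. -/
noncomputable def iterDirDeriv (f : E → F) : (j : ℕ) → E → (Fin j → E) → F
  | 0, x, _ => f x
  | j + 1, x, y => lineDeriv ℝ (fun z => iterDirDeriv f j z (Fin.init y)) x (y (Fin.last j))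

/-- `BastianiOn k f S`: the map `f : S → F` is `C^k` in the sense of Bastiani, where `S` is open or,
more generally, a locally convex set with dense interior. That is, `f` is continuous on `S`,
the iterated directional derivatives up to order `k` exist in the interior of `S`, and
for each `j ≤ k` the map `(x, y₁, …, y_j) ↦ d^j f (x, y₁, …, y_j)` has a continuous extension from
`interior S × E^j` to `S × E^j`. (If `S` is open, this says that `d^j f` is continuous
on `S × E^j`.) Only the values of `f` on `S` matter. -/
structure BastianiOn (k : ℕ∞) (f : E → F) (S : Set E) : Prop where
  continuousOn : ContinuousOn f S
  lineDifferentiableAt : ∀ j : ℕ, ((j + 1 : ℕ) : ℕ∞) ≤ k → ∀ x ∈ interior S,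
    ∀ (y : Fin j → E) (v : E), LineDifferentiableAt ℝ (fun z => iterDirDeriv f j z y) x v
  exists_extension : ∀ j : ℕ, (j : ℕ∞) ≤ k → ∃ g : E × (Fin j → E) → F,
    ContinuousOn g (S ×ˢ univ) ∧ ∀ x ∈ interior S, ∀ y, g (x, y) = iterDirDeriv f j x y

end Bastiani

/-! ### Vector measures with a density, non-atomic vector measures -/

section VectorMeasures

variable {X : Type*} [MeasurableSpace X] {E : Type*} [NormedAddCommGroup E]

/-- `A` is an atom of the vector measure `μ`. -/
def IsVectorAtom (μ : VectorMeasure X E) (A : Set X) : Prop :=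
  MeasurableSet A ∧ μ A ≠ 0 ∧ ∀ B, MeasurableSet B → B ⊆ A → μ B = μ A ∨ μ B = 0

/-- A vector measure is non-atomic if it has no atoms. -/
def IsNonAtomic (μ : VectorMeasure X E) : Prop := ∀ A, ¬ IsVectorAtom μ A

variable [NormedSpace ℝ E]

/-- `μ = ρ dν` for some finite positive measure `ν` and some Bochner integrable `ρ`. -/
def HasDensity (μ : VectorMeasure X E) : Prop :=
  ∃ (ν : Measure X) (ρ : X → E), IsFiniteMeasure ν ∧ Integrable ρ ν ∧ μ = ν.withDensityᵥ ρ

/-- A vector measure with a density has finite total variation. -/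
theorem HasDensity.variation_ne_top {μ : VectorMeasure X E} (h : HasDensity μ) :
    μ.variation univ ≠ ⊤ := by
  obtain ⟨ν, ρ, _, hρ, rfl⟩ := h
  have key : (ν.withDensityᵥ ρ).variation ≤ ν.withDensity (fun x => ‖ρ x‖ₑ) := by
    refine VectorMeasure.variation_le_of_forall_enorm_le fun A hA => ?_
    rw [withDensityᵥ_apply hρ hA, withDensity_apply _ hA]
    exact enorm_integral_le_lintegral_enorm _
  refine ne_top_of_le_ne_top ?_ (key univ)
  rw [withDensity_apply _ MeasurableSet.univ, setLIntegral_univ]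
  exact hρ.2.ne

theorem HasDensity.zero : HasDensity (0 : VectorMeasure X E) :=
  ⟨0, 0, inferInstance, integrable_zero _ _ _, by simp⟩

theorem HasDensity.smul {μ : VectorMeasure X E} (h : HasDensity μ) (c : ℝ) :
    HasDensity (c • μ) := by
  obtain ⟨ν, ρ, hν, hρ, rfl⟩ := h
  exact ⟨ν, c • ρ, hν, hρ.smul c, (withDensityᵥ_smul ρ c).symm⟩

theorem HasDensity.of_le {ν₁ ν : Measure X} [IsFiniteMeasure ν₁] [IsFiniteMeasure ν]
    (hle : ν₁ ≤ ν) {ρ : X → E} (hρ : Integrable ρ ν₁) :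
    ∃ ρ' : X → E, Integrable ρ' ν ∧ ν₁.withDensityᵥ ρ = ν.withDensityᵥ ρ' := by
  have h1 : ν.withDensity (ν₁.rnDeriv ν) = ν₁ :=
    Measure.withDensity_rnDeriv_eq _ _ (Measure.absolutelyContinuous_of_le hle)
  have hm : AEMeasurable (ν₁.rnDeriv ν) ν := (Measure.measurable_rnDeriv _ _).aemeasurable
  have hlt : ∀ᵐ x ∂ν, ν₁.rnDeriv ν x < ⊤ := Measure.rnDeriv_lt_top _ _
  have hi : Integrable (fun x => (ν₁.rnDeriv ν x).toReal • ρ x) ν := by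
    rw [← integrable_withDensity_iff_integrable_smul₀' hm hlt, h1]
    exact hρ
  exact ⟨_, hi, by rw [withDensityᵥ_smul_eq_withDensityᵥ_withDensity' hm hlt hi, h1]⟩

theorem HasDensity.add {μ₁ μ₂ : VectorMeasure X E} (h₁ : HasDensity μ₁) (h₂ : HasDensity μ₂) :
    HasDensity (μ₁ + μ₂) := by
  obtain ⟨ν₁, ρ₁, _, hρ₁, rfl⟩ := h₁
  obtain ⟨ν₂, ρ₂, _, hρ₂, rfl⟩ := h₂
  obtain ⟨ρ₁', hi₁, e₁⟩ := HasDensity.of_le (ν := ν₁ + ν₂) (Measure.le_add_right le_rfl) hρ₁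
  obtain ⟨ρ₂', hi₂, e₂⟩ := HasDensity.of_le (ν := ν₁ + ν₂) (Measure.le_add_left le_rfl) hρ₂
  exact ⟨ν₁ + ν₂, ρ₁' + ρ₂', inferInstance, hi₁.add hi₂,
    by rw [e₁, e₂, withDensityᵥ_add hi₁ hi₂]⟩

end VectorMeasures

/-! ### The space `BV([a,b],E)` -/

section BVSpace

variable {a b : ℝ} [hab : Fact (a < b)]
  {E : Type*} [NormedAddCommGroup E] [NormedSpace ℝ E] [CompleteSpace E]

/-- The left endpoint `a` of `[a,b]`. -/
def leftPt (a b : ℝ) [hab : Fact (a < b)] : Icc a b := ⟨a, left_mem_Icc.2 hab.out.le⟩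

/-- A vector measure with a density on `[a,b]` is non-atomic if and only if points are
null sets. -/
theorem isNonAtomic_iff {μ : VectorMeasure (Icc a b) E} (h : HasDensity μ) :
    IsNonAtomic μ ↔ ∀ x, μ {x} = 0 := by
  constructor
  · intro hna x
    by_contra hx
    refine hna {x} ⟨measurableSet_singleton x, hx, fun B _ hBx => ?_⟩
    rcases subset_singleton_iff_eq.1 hBx with rfl | rfl
    · right; simp
    · left; rfl
  · rintro hpt A ⟨hA, hA0, hat⟩
    obtain ⟨ν, ρ, _, hρ, rfl⟩ := h
    set μ := ν.withDensityᵥ ρ with hμ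
    have hg : ∀ x : Icc a b, μ (A ∩ Iic x) = ∫ s, (A ∩ Iic x).indicator ρ s ∂ν := by
      intro x
      have hm : MeasurableSet (A ∩ Iic x) := hA.inter measurableSet_Iic
      rw [hμ, withDensityᵥ_apply hρ hm, integral_indicator hm]
    have hcont : Continuous fun x : Icc a b => μ (A ∩ Iic x) := by
      simp_rw [hg]
      rw [continuous_iff_continuousAt]
      intro x₀
      refine tendsto_integral_filter_of_dominated_convergence (fun s => ‖ρ s‖) ?_ ?_ hρ.norm ?_
      · exact Filter.Eventually.of_forall fun x =>
          (hρ.indicator (hA.inter measurableSet_Iic)).aestronglyMeasurable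
      · exact Filter.Eventually.of_forall fun x => Filter.Eventually.of_forall fun s =>
          norm_indicator_le_norm_self _ _
      · have hne : ∀ s, s ≠ x₀ → Filter.Tendsto (fun x => (A ∩ Iic x).indicator ρ s) (𝓝 x₀)
            (𝓝 ((A ∩ Iic x₀).indicator ρ s)) := by
          intro s hs
          refine tendsto_const_nhds.congr' ?_
          rcases lt_or_gt_of_ne hs with hlt | hgt
          · filter_upwards [lt_mem_nhds hlt] with x hx
            have e : s ∈ A ∩ Iic x₀ ↔ s ∈ A ∩ Iic x := by
              simp only [mem_inter_iff, mem_Iic, hx.le, hlt.le]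
            by_cases hh : s ∈ A ∩ Iic x
            · rw [indicator_of_mem hh, indicator_of_mem (e.2 hh)]
            · rw [indicator_of_notMem hh, indicator_of_notMem (mt e.1 hh)]
          · filter_upwards [gt_mem_nhds hgt] with x hx
            have e : s ∈ A ∩ Iic x₀ ↔ s ∈ A ∩ Iic x := by
              simp only [mem_inter_iff, mem_Iic, not_le.2 hx, not_le.2 hgt]
            by_cases hh : s ∈ A ∩ Iic x
            · rw [indicator_of_mem hh, indicator_of_mem (e.2 hh)]
            · rw [indicator_of_notMem hh, indicator_of_notMem (mt e.1 hh)]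
        have h0 : ν.real {x₀} • ρ x₀ = 0 := by
          rw [← integral_singleton, ← withDensityᵥ_apply hρ (measurableSet_singleton x₀)]
          exact hpt x₀
        rcases smul_eq_zero.1 h0 with h0 | h0
        · have : ν {x₀} = 0 := (measureReal_eq_zero_iff (by finiteness)).1 h0
          filter_upwards [compl_mem_ae_iff.2 this] with s hs
          exact hne s hs
        · refine Filter.Eventually.of_forall fun s => ?_
          rcases eq_or_ne s x₀ with rfl | hs
          · have : ∀ x : Icc a b, (A ∩ Iic x).indicator ρ s = 0 := fun x => by
              by_cases hh : s ∈ A ∩ Iic x <;> simp [indicator, h0]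
            simp_rw [this]
            exact tendsto_const_nhds
          · exact hne s hs
    have hleft : μ (A ∩ Iic (leftPt a b)) = 0 := by
      have hs : A ∩ Iic (leftPt a b) ⊆ {leftPt a b} := fun x hx =>
        le_antisymm hx.2 (x.2.1)
      rcases subset_singleton_iff_eq.1 hs with he | he
      · rw [he]; simp
      · rw [he]; exact hpt _
    have hright : μ (A ∩ Iic (⟨b, right_mem_Icc.2 hab.out.le⟩ : Icc a b)) = μ A := by
      congr 1
      exact inter_eq_left.2 fun x _ => x.2.2
    have : PreconnectedSpace (Icc a b) := Subtype.preconnectedSpace isPreconnected_Icc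
    have hmid : ‖μ A‖ / 2 ∈ range fun x : Icc a b => ‖μ (A ∩ Iic x)‖ := by
      refine mem_range_of_exists_le_of_exists_ge hcont.norm ⟨leftPt a b, ?_⟩
        ⟨⟨b, right_mem_Icc.2 hab.out.le⟩, ?_⟩
      · rw [hleft, norm_zero]; positivity
      · rw [hright]; linarith [norm_nonneg (μ A)]
    obtain ⟨x, hx⟩ := hmid
    have hpos : 0 < ‖μ A‖ := norm_pos_iff.2 hA0
    rcases hat (A ∩ Iic x) (hA.inter measurableSet_Iic) inter_subset_left with he | he
    · simp only [he] at hx; linarith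
    · simp only [he, norm_zero] at hx; linarith

/-- The relation `μ = f'`: the vector measure `μ` has a density, is non-atomic and satisfies
`f x = f a + μ [a,x]` for all `x ∈ [a,b]`. -/
structure IsBVDeriv (f : Icc a b → E) (μ : VectorMeasure (Icc a b) E) : Prop where
  hasDensity : HasDensity μ
  isNonAtomic : IsNonAtomic μ
  eq_add : ∀ x, f x = f (leftPt a b) + μ (Iic x)

theorem IsBVDeriv.add {f g : Icc a b → E} {μ ν : VectorMeasure (Icc a b) E}
    (hf : IsBVDeriv f μ) (hg : IsBVDeriv g ν) : IsBVDeriv (f + g) (μ + ν) := by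
  have hd := hf.hasDensity.add hg.hasDensity
  refine ⟨hd, (isNonAtomic_iff hd).2 fun x => ?_, fun x => ?_⟩
  · simp [(isNonAtomic_iff hf.hasDensity).1 hf.isNonAtomic x,
      (isNonAtomic_iff hg.hasDensity).1 hg.isNonAtomic x]
  · simp only [Pi.add_apply, _root_.add_apply]
    rw [hf.eq_add x, hg.eq_add x]; abel

theorem IsBVDeriv.smul {f : Icc a b → E} {μ : VectorMeasure (Icc a b) E}
    (hf : IsBVDeriv f μ) (c : ℝ) : IsBVDeriv (c • f) (c • μ) := by
  have hd := hf.hasDensity.smul c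
  refine ⟨hd, (isNonAtomic_iff hd).2 fun x => ?_, fun x => ?_⟩
  · simp [(isNonAtomic_iff hf.hasDensity).1 hf.isNonAtomic x]
  · simp only [Pi.smul_apply, _root_.smul_apply]
    rw [hf.eq_add x, smul_add]

theorem IsBVDeriv.zero : IsBVDeriv (0 : Icc a b → E) 0 :=
  ⟨HasDensity.zero, (isNonAtomic_iff HasDensity.zero).2 fun _ => by simp, fun _ => by simp⟩

theorem IsBVDeriv.unique {f : Icc a b → E} {μ ν : VectorMeasure (Icc a b) E}
    (hμ : IsBVDeriv f μ) (hν : IsBVDeriv f ν) : μ = ν := by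
  have hI : ∀ x, μ (Iic x) = ν (Iic x) := fun x =>
    add_left_cancel ((hμ.eq_add x).symm.trans (hν.eq_add x))
  refine VectorMeasure.ext_of_generateFrom (range Iic) ?_ (borel_eq_generateFrom_Iic (Icc a b) ▸
    BorelSpace.measurable_eq) isPiSystem_Iic ?_
  · rintro _ ⟨x, rfl⟩
    exact hI x
  · have : (univ : Set (Icc a b)) = Iic ⟨b, right_mem_Icc.2 hab.out.le⟩ :=
      (eq_univ_of_forall fun x => x.2.2).symm
    rw [this]; exact hI _

/-- The vector space of `E`-valued `BV`-functions on `[a,b]`, as a space of functions. -/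
def bvFunctions (a b : ℝ) [Fact (a < b)]
    (E : Type*) [NormedAddCommGroup E] [NormedSpace ℝ E] [CompleteSpace E] :
    Submodule ℝ (Icc a b → E) where
  carrier := {f | ∃ μ : VectorMeasure (Icc a b) E, IsBVDeriv f μ}
  add_mem' := fun ⟨μ, hμ⟩ ⟨ν, hν⟩ => ⟨μ + ν, hμ.add hν⟩
  zero_mem' := ⟨0, IsBVDeriv.zero⟩
  smul_mem' := fun c _ ⟨μ, hμ⟩ => ⟨c • μ, hμ.smul c⟩

/-- The space `BV([a,b],E)`. It is a type of its own, such that it does not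
inherit the topology of pointwise convergence. -/
def BV (a b : ℝ) [Fact (a < b)]
    (E : Type*) [NormedAddCommGroup E] [NormedSpace ℝ E] [CompleteSpace E] : Type _ :=
  ↥(bvFunctions a b E)

namespace BV

instance : AddCommGroup (BV a b E) := inferInstanceAs (AddCommGroup ↥(bvFunctions a b E))

instance : Module ℝ (BV a b E) := inferInstanceAs (Module ℝ ↥(bvFunctions a b E))

instance : CoeFun (BV a b E) fun _ => Icc a b → E := ⟨fun f => f.1⟩

/-- The vector measure `f'` of a `BV`-function `f`; it is determined by `f`. -/
noncomputable def deriv (f : BV a b E) : VectorMeasure (Icc a b) E := f.2.choose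

theorem isBVDeriv_deriv (f : BV a b E) : IsBVDeriv (f : Icc a b → E) f.deriv := f.2.choose_spec

theorem deriv_add (f g : BV a b E) : (f + g).deriv = f.deriv + g.deriv :=
  (isBVDeriv_deriv (f + g)).unique ((isBVDeriv_deriv f).add (isBVDeriv_deriv g))

theorem deriv_smul (c : ℝ) (f : BV a b E) : (c • f).deriv = c • f.deriv :=
  (isBVDeriv_deriv (c • f)).unique ((isBVDeriv_deriv f).smul c)

/-- The norm `‖f‖ = ‖f(a)‖ + ‖f'‖`, where `‖f'‖` is the total variation of `f'`. -/
noncomputable instance : Norm (BV a b E) :=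
  ⟨fun f => ‖f (leftPt a b)‖ + (f.deriv.variation univ).toReal⟩

theorem norm_def (f : BV a b E) :
    ‖f‖ = ‖f (leftPt a b)‖ + (f.deriv.variation univ).toReal := rfl

theorem normCore : NormedSpace.Core ℝ (BV a b E) where
  norm_nonneg f := by rw [norm_def]; positivity
  norm_smul c f := by
    rw [norm_def, norm_def, deriv_smul, VectorMeasure.variation_smul]
    have : (c • f : BV a b E) (leftPt a b) = c • f (leftPt a b) := rfl
    rw [this, norm_smul]
    simp [mul_add]
  norm_triangle f g := by
    simp only [norm_def, deriv_add]
    have h1 : (f + g : BV a b E) (leftPt a b) = f (leftPt a b) + g (leftPt a b) := rfl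
    have h2 := norm_add_le (f (leftPt a b)) (g (leftPt a b))
    have hf := f.isBVDeriv_deriv.hasDensity.variation_ne_top
    have hg := g.isBVDeriv_deriv.hasDensity.variation_ne_top
    have h3 : ((f.deriv + g.deriv).variation univ).toReal ≤
        (f.deriv.variation univ).toReal + (g.deriv.variation univ).toReal := by
      rw [← ENNReal.toReal_add hf hg]
      exact ENNReal.toReal_mono (ENNReal.add_ne_top.2 ⟨hf, hg⟩)
        (VectorMeasure.variation_add_le univ)
    rw [h1]; linarith
  norm_eq_zero_iff f := by
    constructor
    · intro h
      rw [norm_def] at h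
      have h1 : ‖f (leftPt a b)‖ = 0 := by
        linarith [norm_nonneg (f (leftPt a b)),
          ENNReal.toReal_nonneg (a := f.deriv.variation univ)]
      have h2 : (f.deriv.variation univ).toReal = 0 := by linarith
      have h3 : f.deriv.variation univ = 0 :=
        ((ENNReal.toReal_eq_zero_iff _).1 h2).resolve_right
          f.isBVDeriv_deriv.hasDensity.variation_ne_top
      have h4 : f.deriv = 0 := VectorMeasure.variation_eq_zero.1 (Measure.measure_univ_eq_zero.1 h3)
      refine Subtype.ext (funext fun x => ?_)
      have h5 := f.isBVDeriv_deriv.eq_add x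
      rw [h4, norm_eq_zero.1 h1] at h5
      rw [h5]; simp; rfl
    · rintro rfl
      have h1 : (0 : BV a b E).deriv = 0 := (isBVDeriv_deriv 0).unique IsBVDeriv.zero
      have h2 : (0 : BV a b E) (leftPt a b) = 0 := rfl
      rw [norm_def, h1, h2]; simp

noncomputable instance : NormedAddCommGroup (BV a b E) := NormedAddCommGroup.ofCore normCore

noncomputable instance : NormedSpace ℝ (BV a b E) := NormedSpace.ofCore normCore

/-- The subset `BV([a,b],U)` of `BV([a,b],E)`. -/
def inside (a b : ℝ) [Fact (a < b)] (U : Set E) : Set (BV a b E) := {f | ∀ t, f t ∈ U}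

end BV

end BVSpace

/-! ### Bastiani differentiability versus Fréchet differentiability -/

section BastianiFrechet

variable {E F : Type*} [NormedAddCommGroup E] [NormedSpace ℝ E]
  [NormedAddCommGroup F] [NormedSpace ℝ F]

theorem BastianiOn.mono {k l : ℕ∞} {f : E → F} {S : Set E} (h : BastianiOn k f S) (hl : l ≤ k) :
    BastianiOn l f S :=
  ⟨h.continuousOn, fun j hj => h.lineDifferentiableAt j (hj.trans hl),
    fun j hj => h.exists_extension j (hj.trans hl)⟩

theorem HasLineDerivAt.hasDerivAt_add_smul {f : E → F} {x u : E} {f' : F} {t : ℝ}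
    (h : HasLineDerivAt ℝ f f' (x + t • u) u) :
    HasDerivAt (fun s : ℝ => f (x + s • u)) f' t := by
  unfold HasLineDerivAt at h
  have h' : HasDerivAt (fun s : ℝ => f (x + t • u + s • u)) f' (t - t) := by rwa [sub_self]
  have := h'.scomp (h := fun s => s - t) t ((hasDerivAt_id t).sub_const t)
  simp only [one_smul] at this
  refine this.congr_of_eventuallyEq (Filter.Eventually.of_forall fun s => ?_)
  simp [Function.comp, add_assoc, ← add_smul]

/-- If the directional derivatives are jointly continuous, they are additive in the direction. -/
theorem HasLineDerivAt.add_of_continuousOn {f : E → F} {V : Set E} (hV : IsOpen V)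
    {g : E × E → F} (hg : ContinuousOn g (V ×ˢ univ))
    (hf : ∀ x ∈ V, ∀ v, HasLineDerivAt ℝ f (g (x, v)) x v) {x : E} (hx : x ∈ V) (u v : E) :
    g (x, u + v) = g (x, u) + g (x, v) := by
  have hc : Continuous fun z : ℝ × ℝ => x + z.1 • u + z.2 • v := by fun_prop
  have hnhds : ∀ᶠ z : ℝ × ℝ in 𝓝 (0, 0), x + z.1 • u + z.2 • v ∈ V := by
    refine hc.continuousAt.eventually_mem (hV.mem_nhds ?_)
    simpa using hx
  have hga : ∀ w : E, ContinuousAt (fun z : ℝ × ℝ => g (x + z.1 • u + z.2 • v, w)) (0, 0) := by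
    intro w
    have h1 : ContinuousAt g (x + (0 : ℝ) • u + (0 : ℝ) • v, w) :=
      hg.continuousAt ((hV.prod isOpen_univ).mem_nhds ⟨by simpa using hx, mem_univ _⟩)
    exact ContinuousAt.comp (f := fun z : ℝ × ℝ => (x + z.1 • u + z.2 • v, w)) h1
      (hc.prodMk continuous_const).continuousAt
  -- The map (s,t) ↦ f(x + su + tv) has partial derivatives near 0 that are continuous at 0, so it
  -- is differentiable there. Its derivative along the diagonal is the sum of the partials.
  have key := hasStrictFDerivAt_uncurry_coprod (𝕜 := ℝ) (u := ((0 : ℝ), (0 : ℝ)))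
    (f := fun s t => f (x + s • u + t • v))
    (f₁ := fun s t => ContinuousLinearMap.toSpanSingleton ℝ (g (x + s • u + t • v, u)))
    (f₂ := fun s t => ContinuousLinearMap.toSpanSingleton ℝ (g (x + s • u + t • v, v)))
    (by
      filter_upwards [hnhds] with z hz
      have := HasLineDerivAt.hasDerivAt_add_smul (x := x + z.2 • v) (t := z.1) (u := u)
        (f := f) (by rw [add_right_comm]; exact hf _ hz u)
      simp_rw [add_right_comm x (z.2 • v)] at this
      exact this.hasFDerivAt)
    (by
      filter_upwards [hnhds] with z hz
      exact (HasLineDerivAt.hasDerivAt_add_smul (x := x + z.1 • u) (t := z.2) (u := v)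
        (hf _ hz v)).hasFDerivAt)
    ((ContinuousLinearMap.toSpanSingletonCLE (𝕜 := ℝ) (E := F)).continuous.continuousAt.comp
      (hga u))
    ((ContinuousLinearMap.toSpanSingletonCLE (𝕜 := ℝ) (E := F)).continuous.continuousAt.comp
      (hga v))
  have hdiag : HasDerivAt (fun t : ℝ => ((t, t) : ℝ × ℝ)) (1, 1) 0 :=
    (hasDerivAt_id (0 : ℝ)).prodMk (hasDerivAt_id 0)
  have h2 := key.hasFDerivAt.comp_hasDerivAt (f := fun t : ℝ => (t, t)) (0 : ℝ) hdiag
  have h3 := hf x hx (u + v)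
  unfold HasLineDerivAt at h3
  have h4 := h3.unique (h2.congr_of_eventuallyEq (Filter.Eventually.of_forall fun t => by
    simp [Function.HasUncurry.uncurry, add_assoc]))
  simpa [Function.HasUncurry.uncurry] using h4

theorem BastianiOn.hasLineDerivAt {k : ℕ∞} {f : E → F} {S : Set E} (h : BastianiOn k f S) {j : ℕ}
    (hj : ((j + 1 : ℕ) : ℕ∞) ≤ k) {x : E} (hx : x ∈ interior S) (y : Fin j → E) (v : E) :
    HasLineDerivAt ℝ (fun z => iterDirDeriv f j z y)
      (iterDirDeriv f (j + 1) x (Fin.snoc y v : Fin (j + 1) → E)) x v := by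
  have := (h.lineDifferentiableAt j hj x hx y v).hasLineDerivAt
  simpa [iterDirDeriv] using this

/-- In the last slot, additivity comes from joint continuity of the directional derivative, and
homogeneity is automatic. In earlier slots, both identities hold at order `j` near x and are
differentiated in the last direction. -/
theorem BastianiOn.iterDirDeriv_update {k : ℕ∞} {f : E → F} {S : Set E} (h : BastianiOn k f S) :
    ∀ {j : ℕ}, (j : ℕ∞) ≤ k → ∀ x ∈ interior S, ∀ (y : Fin j → E) (i : Fin j),
      (∀ c d : E, iterDirDeriv f j x (Function.update y i (c + d)) =
        iterDirDeriv f j x (Function.update y i c) + iterDirDeriv f j x (Function.update y i d)) ∧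
      ∀ (r : ℝ) (c : E), iterDirDeriv f j x (Function.update y i (r • c)) =
        r • iterDirDeriv f j x (Function.update y i c)
  | 0, _, _, _, _, i => i.elim0
  | j + 1, hj, x, hx, y, i => by
    have hj' : (j : ℕ∞) ≤ k := le_trans (by exact_mod_cast j.le_succ) hj
    have IH := h.iterDirDeriv_update hj'
    have hnear : ∀ᶠ z in 𝓝 x, z ∈ interior S := isOpen_interior.mem_nhds hx
    induction i using Fin.lastCases with
    | last =>
      refine ⟨fun c d => ?_, fun r c => ?_⟩
      · obtain ⟨g, hg, hgf⟩ := h.exists_extension (j + 1) hj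
        have hg' : ContinuousOn
            (fun q : E × E => g (q.1, (Fin.snoc (Fin.init y) q.2 : Fin (j + 1) → E)))
            (interior S ×ˢ univ) := by
          refine hg.comp (Continuous.continuousOn ?_) fun q hq => ⟨interior_subset hq.1, mem_univ _⟩
          exact continuous_fst.prodMk (Continuous.finSnoc continuous_const continuous_snd)
        have := HasLineDerivAt.add_of_continuousOn isOpen_interior hg'
          (f := fun z => iterDirDeriv f j z (Fin.init y)) (fun z hz v => by
            rw [hgf z hz]; exact h.hasLineDerivAt hj hz _ v) hx c d
        simp only [hgf x hx] at this
        have e : ∀ c, Function.update y (Fin.last j) c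
            = (Fin.snoc (Fin.init y) c : Fin (j + 1) → E) := fun c => by
          rw [← Fin.snoc_init_self (Function.update y (Fin.last j) c), Fin.init_update_last,
            Function.update_self]
        rw [e, e, e]; exact this
      · simp only [iterDirDeriv, Fin.init_update_last, Function.update_self, lineDeriv_smul]
    | cast i =>
      have hlast : ∀ c, Function.update y i.castSucc c (Fin.last j) = y (Fin.last j) := fun c =>
        Function.update_of_ne (Fin.castSucc_lt_last i).ne' _ _
      have hd : ∀ c, HasLineDerivAt ℝ
          (fun z => iterDirDeriv f j z (Function.update (Fin.init y) i c))
          (iterDirDeriv f (j + 1) x (Function.update y i.castSucc c)) x (y (Fin.last j)) := by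
        intro c
        have := (h.lineDifferentiableAt j hj x hx (Function.update (Fin.init y) i c)
          (y (Fin.last j))).hasLineDerivAt
        simpa [iterDirDeriv, Fin.init_update_castSucc, hlast] using this
      refine ⟨fun c d => ?_, fun r c => ?_⟩
      · refine (hd (c + d)).unique (((hd c).add (hd d)).congr_of_eventuallyEq ?_)
        have hcont : ContinuousAt (fun t : ℝ => x + t • y (Fin.last j)) 0 := by fun_prop
        filter_upwards [hcont.eventually_mem
          (isOpen_interior.mem_nhds (by simpa using hx : x + (0 : ℝ) • y (Fin.last j) ∈ interior S))]
          with t ht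
        exact (IH _ ht (Fin.init y) i).1 c d
      · refine (hd (r • c)).unique (((hd c).const_smul r).congr_of_eventuallyEq ?_)
        have hcont : ContinuousAt (fun t : ℝ => x + t • y (Fin.last j)) 0 := by fun_prop
        filter_upwards [hcont.eventually_mem
          (isOpen_interior.mem_nhds (by simpa using hx : x + (0 : ℝ) • y (Fin.last j) ∈ interior S))]
          with t ht
        exact (IH _ ht (Fin.init y) i).2 r c

/-- The iterated directional derivatives of a `C^k`-map extend to continuous multilinear maps
on all of `S`, with the order of the arguments reversed. -/
theorem BastianiOn.exists_multilinear {k : ℕ∞} {f : E → F} {S : Set E} (h : BastianiOn k f S)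
    (hS : S ⊆ closure (interior S)) {j : ℕ} (hj : (j : ℕ∞) ≤ k) :
    ∃ p : E → ContinuousMultilinearMap ℝ (fun _ : Fin j => E) F,
      ContinuousOn (fun q : E × (Fin j → E) => p q.1 q.2) (S ×ˢ univ) ∧
      ∀ x ∈ interior S, ∀ y, p x y = iterDirDeriv f j x (y ∘ Fin.rev) := by
  obtain ⟨g, hg, hgf⟩ := h.exists_extension j hj
  have hgx : ∀ x ∈ S, Continuous fun y => g (x, y) := fun x hx =>
    hg.comp_continuous (by fun_prop) fun y => ⟨hx, mem_univ y⟩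
  have hgy : ∀ y, ContinuousOn (fun x => g (x, y)) S := fun y =>
    hg.comp (by fun_prop) fun x hx => ⟨hx, mem_univ y⟩
  have hupd := h.iterDirDeriv_update hj
  have ext_eq : ∀ {u v : E → F}, ContinuousOn u S → ContinuousOn v S →
      (∀ x ∈ interior S, u x = v x) → ∀ x ∈ S, u x = v x := fun hu hv huv =>
    EqOn.of_subset_closure huv hu hv interior_subset hS
  -- `iterDirDeriv` appends the newest direction at the end, while Taylor series in Mathlib put it
  -- first; hence the reversal.
  have hrev : ∀ (y : Fin j → E) (i : Fin j) (c : E),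
      Function.update y i c ∘ Fin.rev = Function.update (y ∘ Fin.rev) i.rev c := fun y i c => by
    ext l
    by_cases hl : l = i.rev
    · subst hl; simp
    · have : l.rev ≠ i := fun hh => hl (by rw [← hh, Fin.rev_rev])
      simp [Function.update_of_ne hl, Function.update_of_ne this]
  have hex : ∀ x, ∃ q : ContinuousMultilinearMap ℝ (fun _ : Fin j => E) F,
      x ∈ S → ∀ y, q y = g (x, y ∘ Fin.rev) := by
    intro x
    by_cases hx : x ∈ S
    -- Multilinearity is an identity between continuous functions of x, so it passes from the dense
    -- interior to all of `S`.
    · refine ⟨⟨MultilinearMap.mk' (fun y => g (x, y ∘ Fin.rev)) (fun y i c d => ?_)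
        (fun y i r c => ?_), (hgx x hx).comp (by fun_prop)⟩, fun _ y => rfl⟩
      · simp only [hrev]
        exact ext_eq (hgy _) ((hgy _).add (hgy _)) (fun z hz => by
          simp only [Pi.add_apply, hgf z hz]; exact (hupd z hz _ _).1 c d) x hx
      · simp only [hrev]
        exact ext_eq (hgy _) ((hgy _).const_smul r) (fun z hz => by
          simp only [Pi.smul_apply, hgf z hz]; exact (hupd z hz _ _).2 r c) x hx
    · exact ⟨0, fun hx' => absurd hx' hx⟩
  choose q hq using hex
  refine ⟨q, ?_, fun x hx y => (hq x (interior_subset hx) y).trans (hgf x hx _)⟩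
  exact ContinuousOn.congr (f := fun q : E × (Fin j → E) => g (q.1, q.2 ∘ Fin.rev))
    (hg.comp (by fun_prop) fun q hq => ⟨hq.1, mem_univ _⟩) fun z hz => hq z.1 hz.1 z.2

/-- Joint continuity at (x, 0) bounds the values on a ball of directions whose radius is uniform in
z; rescaling turns this into an operator norm bound. -/
theorem ContinuousMultilinearMap.eventually_norm_le {j : ℕ} {S : Set E}
    {p : E → ContinuousMultilinearMap ℝ (fun _ : Fin j => E) F}
    (hp : ContinuousOn (fun q : E × (Fin j → E) => p q.1 q.2) (S ×ˢ univ)) {x : E} (hx : x ∈ S) :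
    ∃ C : ℝ, ∀ᶠ z in 𝓝[S] x, ‖p z‖ ≤ C := by
  have h1 := hp (x, 0) ⟨hx, mem_univ _⟩
  rw [Metric.continuousWithinAt_iff] at h1
  obtain ⟨δ, hδ, h1⟩ := h1 1 one_pos
  -- It suffices to test vectors in the shell δ/2 ≤ ‖m i‖ < δ, where the value is at most ‖p x 0‖ +
  -- 1 and the product of norms at least (δ/2)^j.
  refine ⟨(‖p x 0‖ + 1) * (2 / δ) ^ j, ?_⟩
  filter_upwards [self_mem_nhdsWithin, mem_nhdsWithin_of_mem_nhds (Metric.ball_mem_nhds x hδ)]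
    with z hzS hz
  refine ContinuousMultilinearMap.opNorm_le_bound (by positivity) ?_
  refine MultilinearMap.bound_of_shell_of_continuous (p z).toMultilinearMap (p z).cont
    (fun _ => hδ) (c := fun _ => (2 : ℝ)) (fun _ => by norm_num) fun m hcm hm => ?_
  have h2 : dist (p z m) (p x 0) < 1 := by
    refine h1 (x := (z, m)) ⟨hzS, mem_univ _⟩ ?_
    rw [Prod.dist_eq]
    refine max_lt hz ?_
    rw [dist_zero_right]
    exact (pi_norm_lt_iff hδ).2 hm
  have h3 : ‖p z m‖ ≤ ‖p x 0‖ + 1 := by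
    have := norm_le_norm_add_norm_sub' (p z m) (p x 0)
    rw [dist_eq_norm] at h2
    linarith
  refine h3.trans ?_
  rw [mul_assoc]
  refine le_mul_of_one_le_right (by positivity) ?_
  have h4 : (δ / 2) ^ j ≤ ∏ i, ‖m i‖ := by
    have : (δ / 2) ^ j = ∏ _i : Fin j, δ / 2 := by rw [Finset.prod_const, Finset.card_fin]
    rw [this]
    refine Finset.prod_le_prod (fun _ _ => by positivity) fun i _ => ?_
    simpa using hcm i
  calc (1 : ℝ) = (2 / δ) ^ j * (δ / 2) ^ j := by
        rw [← mul_pow]; field_simp; simp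
    _ ≤ _ := by gcongr

/-- A mean value inequality for the extended iterated directional derivatives. -/
theorem ContinuousMultilinearMap.norm_sub_sub_le_of_hasLineDerivAt {j : ℕ} {S N : Set E}
    {p : E → ContinuousMultilinearMap ℝ (fun _ : Fin j => E) F}
    {p' : E → ContinuousMultilinearMap ℝ (fun _ : Fin (j + 1) => E) F}
    (hp : ContinuousOn (fun q : E × (Fin j → E) => p q.1 q.2) (S ×ˢ univ))
    (hd : ∀ x ∈ interior S, ∀ y v,
      HasLineDerivAt ℝ (fun z => p z y) (p' x (Fin.cons v y : Fin (j + 1) → E)) x v)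
    (hN : Convex ℝ N) (hNS : N ⊆ S) (hNi : N ⊆ closure (interior N))
    {A : ContinuousMultilinearMap ℝ (fun _ : Fin (j + 1) => E) F} {ε : ℝ}
    (hε : ∀ w ∈ interior N, ‖p' w - A‖ ≤ ε) {x z : E} (hx : x ∈ N) (hz : z ∈ N) :
    ‖p z - p x - A.curryLeft (z - x)‖ ≤ ε * ‖z - x‖ := by
  have hε0 : 0 ≤ ε := by
    obtain ⟨w, hw⟩ : (interior N).Nonempty := by
      rw [← closure_nonempty_iff]; exact ⟨x, hNi hx⟩
    exact (norm_nonneg _).trans (hε w hw)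
  refine ContinuousMultilinearMap.opNorm_le_bound (by positivity) fun y => ?_
  have hpy : ContinuousOn (fun x => p x y) N :=
    hp.comp (f := fun x => (x, y)) (by fun_prop) fun x hx => ⟨hNS hx, mem_univ y⟩
  -- Line derivatives exist only in the interior, so the mean value inequality is applied to
  -- segments there and extended to `N` by continuity.
  have hint : ∀ q ∈ interior N ×ˢ interior N,
      ‖p q.2 y - p q.1 y - A.curryLeft (q.2 - q.1) y‖ ≤ ε * ‖q.2 - q.1‖ * ∏ i, ‖y i‖ := by
    rintro ⟨x, z⟩ ⟨hx, hz⟩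
    have hseg : ∀ s ∈ Icc (0 : ℝ) 1, x + s • (z - x) ∈ interior N := fun s hs =>
      hN.interior.add_smul_sub_mem hx hz hs
    have hder : ∀ s ∈ Icc (0 : ℝ) 1, HasDerivWithinAt
        (fun s : ℝ => p (x + s • (z - x)) y - s • A (Fin.cons (z - x) y : Fin (j + 1) → E))
        ((p' (x + s • (z - x)) - A) (Fin.cons (z - x) y : Fin (j + 1) → E)) (Icc 0 1) s := by
      intro s hs
      have h1 := (hd _ (interior_mono hNS (hseg s hs)) y (z - x)).hasDerivAt_add_smul
      have h2 := (hasDerivAt_id s).smul_const (A (Fin.cons (z - x) y : Fin (j + 1) → E))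
      rw [one_smul] at h2
      exact (h1.sub h2).hasDerivWithinAt
    have h3 := norm_image_sub_le_of_norm_deriv_le_segment_01' hder
      (C := ε * ‖z - x‖ * ∏ i, ‖y i‖) fun s hs => by
        refine ((p' (x + s • (z - x)) - A).le_of_opNorm_le
          (hε _ (hseg s (Ico_subset_Icc_self hs))) _).trans_eq ?_
        rw [Fin.prod_univ_succ]
        simp [mul_assoc]
    rw [ContinuousMultilinearMap.curryLeft_apply]
    simpa [sub_right_comm] using h3
  have hcl : ((x, z) : E × E) ∈ closure (interior N ×ˢ interior N) := by
    rw [closure_prod_eq]; exact ⟨hNi hx, hNi hz⟩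
  have hc1 : ContinuousOn (fun q : E × E => p q.1 y) (N ×ˢ N) :=
    hpy.comp continuousOn_fst fun q hq => hq.1
  have hc2 : ContinuousOn (fun q : E × E => p q.2 y) (N ×ˢ N) :=
    hpy.comp continuousOn_snd fun q hq => hq.2
  have hc3 : Continuous fun q : E × E => A.curryLeft (q.2 - q.1) y := by
    have : Continuous fun q : E × E => A (Fin.cons (q.2 - q.1) y : Fin (j + 1) → E) :=
      A.cont.comp (Continuous.finCons (by fun_prop) continuous_const)
    simpa only [ContinuousMultilinearMap.curryLeft_apply] using this
  have hsub : interior N ×ˢ interior N ⊆ N ×ˢ N := prod_mono interior_subset interior_subset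
  have := ContinuousWithinAt.closure_le (x := ((x, z) : E × E))
    (f := fun q : E × E => ‖p q.2 y - p q.1 y - A.curryLeft (q.2 - q.1) y‖)
    (g := fun q : E × E => ε * ‖q.2 - q.1‖ * ∏ i, ‖y i‖) hcl
    ((((hc2.sub hc1).sub hc3.continuousOn).norm _ ⟨hx, hz⟩).mono hsub)
    (Continuous.continuousWithinAt (by fun_prop)) hint
  simpa using this

/-- A `C^{n+1}`-map in the sense of Bastiani is `C^n` in the sense of Fréchet. -/
theorem BastianiOn.contDiffOn {n : ℕ} {f : E → F} {S : Set E}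
    (h : BastianiOn ((n + 1 : ℕ) : ℕ∞) f S) (hS : S ⊆ closure (interior S))
    (hconv : ∀ x ∈ S, ∃ r > 0, Convex ℝ (S ∩ Metric.ball x r)) : ContDiffOn ℝ n f S := by
  have hex : ∀ j : ℕ, ∃ p : E → ContinuousMultilinearMap ℝ (fun _ : Fin j => E) F,
      j ≤ n + 1 → ContinuousOn (fun q : E × (Fin j → E) => p q.1 q.2) (S ×ˢ univ) ∧
        ∀ x ∈ interior S, ∀ y, p x y = iterDirDeriv f j x (y ∘ Fin.rev) := fun j => by
    by_cases hj : j ≤ n + 1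
    · obtain ⟨p, hp⟩ := h.exists_multilinear hS (j := j) (by exact_mod_cast hj)
      exact ⟨p, fun _ => hp⟩
    · exact ⟨0, fun hj' => absurd hj' hj⟩
  choose p hp using hex
  have hd : ∀ j, j + 1 ≤ n + 1 → ∀ x ∈ interior S, ∀ y v, HasLineDerivAt ℝ (fun z => p j z y)
      (p (j + 1) x (Fin.cons v y : Fin (j + 1) → E)) x v := by
    intro j hj x hx y v
    rw [(hp (j + 1) hj).2 x hx, Fin.cons_comp_rev]
    refine (h.hasLineDerivAt (by exact_mod_cast hj) hx (y ∘ Fin.rev) v).congr_of_eventuallyEq ?_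
    filter_upwards [isOpen_interior.mem_nhds hx] with z hz
    exact (hp j (by omega)).2 z hz y
  have hNi : ∀ x r, S ∩ Metric.ball x r ⊆ closure (interior (S ∩ Metric.ball x r)) := by
    intro x r z hz
    rw [interior_inter, Metric.isOpen_ball.interior_eq, inter_comm]
    exact Metric.isOpen_ball.inter_closure ⟨hz.2, hS hz.1⟩
  have hshrink : ∀ x ∈ S, ∀ t ∈ 𝓝[S] x, ∃ r > 0, Convex ℝ (S ∩ Metric.ball x r) ∧
      S ∩ Metric.ball x r ⊆ t := by
    intro x hx t ht
    obtain ⟨r, hr, hc⟩ := hconv x hx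
    obtain ⟨r', hr', hsub⟩ := Metric.mem_nhdsWithin_iff.1 ht
    refine ⟨min r r', lt_min hr hr', ?_, ?_⟩
    · have : S ∩ Metric.ball x (min r r') = (S ∩ Metric.ball x r) ∩ Metric.ball x r' := by
        ext z; simp [and_assoc]
      rw [this]
      exact hc.inter (convex_ball x r')
    · exact fun z hz => hsub ⟨Metric.ball_subset_ball (min_le_right _ _) hz.2, hz.1⟩
  -- This is where an order is lost: a local bound on `p (j + 1)` gives ‖p j z - p j x‖ ≤ C‖z - x‖,
  -- by the mean value inequality with `A = 0`.
  have hcont : ∀ j ≤ n, ContinuousOn (p j) S := by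
    intro j hj x hx
    obtain ⟨C, hC⟩ := ContinuousMultilinearMap.eventually_norm_le (hp (j + 1) (by omega)).1 hx
    obtain ⟨r, hr, hN, hNC⟩ := hshrink x hx _ hC
    have hlip : ∀ z ∈ S ∩ Metric.ball x r, ‖p j z - p j x‖ ≤ C * ‖z - x‖ := fun z hz => by
      have := ContinuousMultilinearMap.norm_sub_sub_le_of_hasLineDerivAt (hp j (by omega)).1
        (hd j (by omega)) hN inter_subset_left (hNi x r) (A := 0) (ε := C)
        (fun w hw => by simpa using hNC (interior_subset hw))
        ⟨hx, Metric.mem_ball_self hr⟩ hz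
      have h0 : (0 : ContinuousMultilinearMap ℝ (fun _ : Fin (j + 1) => E) F).curryLeft (z - x)
          = 0 := by ext; simp
      rwa [h0, sub_zero] at this
    refine tendsto_iff_norm_sub_tendsto_zero.2 (squeeze_zero' (g := fun z => C * ‖z - x‖)
      (Filter.Eventually.of_forall fun _ => norm_nonneg _) ?_ ?_)
    · filter_upwards [self_mem_nhdsWithin,
        mem_nhdsWithin_of_mem_nhds (Metric.ball_mem_nhds x hr)] with z hz hz'
      exact hlip z ⟨hz, hz'⟩
    · have : ContinuousWithinAt (fun z => C * ‖z - x‖) S x :=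
        Continuous.continuousWithinAt (by fun_prop)
      simpa [ContinuousWithinAt] using this
  refine HasFTaylorSeriesUpToOn.contDiffOn (n := (n : ℕ∞)) (f' := fun x j => p j x)
    ⟨fun x hx => ?_, fun j hj x hx => ?_, fun j hj => hcont j (by exact_mod_cast hj)⟩
  · refine EqOn.of_subset_closure (s := interior S) (t := S)
      (f := fun x => (p 0 x).curry0) (g := f) (fun z hz => ?_) ?_ h.continuousOn
      interior_subset hS hx
    · exact (hp 0 (by omega)).2 z hz _
    · exact (hp 0 (by omega)).1.comp (f := fun x => (x, (0 : Fin 0 → E))) (by fun_prop)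
        fun x hx => ⟨hx, mem_univ _⟩
  · have hj : j + 1 ≤ n := by exact_mod_cast hj
    -- Now `p (j + 1)` is norm-continuous, so the mean value inequality with `A = p (j + 1) x` gives
    -- Fréchet differentiability.
    rw [hasFDerivWithinAt_iff_isLittleO, Asymptotics.isLittleO_iff]
    intro ε hε
    have hnear : ∀ᶠ z in 𝓝[S] x, ‖p (j + 1) z - p (j + 1) x‖ ≤ ε := by
      have := (hcont (j + 1) hj x hx).eventually (Metric.closedBall_mem_nhds _ hε)
      simpa only [Metric.mem_closedBall, dist_eq_norm] using this
    obtain ⟨r, hr, hN, hNε⟩ := hshrink x hx _ hnear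
    filter_upwards [self_mem_nhdsWithin,
      mem_nhdsWithin_of_mem_nhds (Metric.ball_mem_nhds x hr)] with z hz hz'
    exact ContinuousMultilinearMap.norm_sub_sub_le_of_hasLineDerivAt (hp j (by omega)).1
      (hd j (by omega)) hN inter_subset_left (hNi x r)
      (fun w hw => hNε (interior_subset hw)) ⟨hx, Metric.mem_ball_self hr⟩ ⟨hz, hz'⟩

theorem iterDirDeriv_eq_iteratedFDeriv {k : ℕ∞} {f : E → F} {S : Set E} (hS : IsOpen S)
    (h : ContDiffOn ℝ k f S) : ∀ {j : ℕ}, (j : ℕ∞) ≤ k → ∀ x ∈ S, ∀ y : Fin j → E,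
      iterDirDeriv f j x y = iteratedFDeriv ℝ j f x (y ∘ Fin.rev)
  | 0, _, _, _, _ => by simp [iterDirDeriv]
  | j + 1, hj, x, hx, y => by
    have hlt : ((j : ℕ) : WithTop ℕ∞) < k := by
      exact_mod_cast lt_of_lt_of_le (by exact_mod_cast j.lt_succ_self) hj
    have hdiff : DifferentiableAt ℝ (iteratedFDeriv ℝ j f) x :=
      ((h x hx).contDiffAt (hS.mem_nhds hx)).differentiableAt_iteratedFDeriv hlt
    have hd : HasFDerivAt (fun z => iterDirDeriv f j z (Fin.init y))
        ((ContinuousMultilinearMap.apply ℝ (fun _ : Fin j => E) F (Fin.init y ∘ Fin.rev)).comp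
          (fderiv ℝ (iteratedFDeriv ℝ j f) x)) x := by
      refine ((ContinuousMultilinearMap.apply ℝ (fun _ : Fin j => E) F
        (Fin.init y ∘ Fin.rev)).hasFDerivAt.comp x hdiff.hasFDerivAt).congr_of_eventuallyEq ?_
      filter_upwards [hS.mem_nhds hx] with z hz
      exact iterDirDeriv_eq_iteratedFDeriv hS h (le_trans (by exact_mod_cast j.le_succ) hj) z hz _
    have e : y ∘ Fin.rev = (Fin.cons (y (Fin.last j)) (Fin.init y ∘ Fin.rev) :
        Fin (j + 1) → E) := by
      rw [← Fin.snoc_comp_rev, Fin.snoc_init_self]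
    rw [iterDirDeriv, (hd.hasLineDerivAt _).lineDeriv, e, iteratedFDeriv_succ_apply_left]
    simp

/-- On open sets, `C^k` in the sense of Fréchet implies `C^k` in the sense of Bastiani. -/
theorem ContDiffOn.bastianiOn {k : ℕ∞} {f : E → F} {S : Set E} (hS : IsOpen S)
    (h : ContDiffOn ℝ k f S) : BastianiOn k f S := by
  refine ⟨h.continuousOn, fun j hj x hx y v => ?_, fun j hj => ?_⟩
  · rw [hS.interior_eq] at hx
    have hlt : ((j : ℕ) : WithTop ℕ∞) < k := by
      exact_mod_cast lt_of_lt_of_le (by exact_mod_cast j.lt_succ_self) hj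
    have hdiff : DifferentiableAt ℝ (iteratedFDeriv ℝ j f) x :=
      ((h x hx).contDiffAt (hS.mem_nhds hx)).differentiableAt_iteratedFDeriv hlt
    have : DifferentiableAt ℝ (fun z => iterDirDeriv f j z y) x := by
      refine ((ContinuousMultilinearMap.apply ℝ (fun _ : Fin j => E) F
        (y ∘ Fin.rev)).differentiableAt.comp x hdiff).congr_of_eventuallyEq ?_
      filter_upwards [hS.mem_nhds hx] with z hz
      exact iterDirDeriv_eq_iteratedFDeriv hS h (le_trans (by exact_mod_cast j.le_succ) hj) z hz _
    exact this.lineDifferentiableAt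
  · refine ⟨fun q => iteratedFDeriv ℝ j f q.1 (q.2 ∘ Fin.rev), ?_, fun x hx y => ?_⟩
    · have hc : ContinuousOn (iteratedFDeriv ℝ j f) S := by
        refine (h.continuousOn_iteratedFDerivWithin (m := j) (by exact_mod_cast hj)
          hS.uniqueDiffOn).congr fun x hx => ?_
        exact (iteratedFDerivWithin_of_isOpen j hS hx).symm
      have hc1 : ContinuousOn (fun q : E × (Fin j → E) => iteratedFDeriv ℝ j f q.1)
        (S ×ˢ univ) := hc.comp continuousOn_fst fun q hq => hq.1
      have hc2 : ContinuousOn (fun q : E × (Fin j → E) => q.2 ∘ Fin.rev) (S ×ˢ univ) :=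
        Continuous.continuousOn (by fun_prop)
      exact hc1.eval hc2
    · rw [hS.interior_eq] at hx
      exact (iterDirDeriv_eq_iteratedFDeriv hS h hj x hx y).symm

end BastianiFrechet

/-! ### Densities of `BV`-functions with respect to measures without atoms -/

section BVDensity

variable {a b : ℝ}
  {E : Type*} [NormedAddCommGroup E] [NormedSpace ℝ E]
  {F : Type*} [NormedAddCommGroup F] [NormedSpace ℝ F]

theorem setIntegral_Iic_sub_Iic {ν : Measure (Icc a b)} {ρ : Icc a b → E} (hρ : Integrable ρ ν)
    {s t : Icc a b} (hst : s ≤ t) :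
    (∫ r in Iic t, ρ r ∂ν) - ∫ r in Iic s, ρ r ∂ν = ∫ r in Ioc s t, ρ r ∂ν := by
  rw [← Iic_union_Ioc_eq_Iic hst, setIntegral_union (Iic_disjoint_Ioc le_rfl) measurableSet_Ioc
    hρ.integrableOn hρ.integrableOn]
  abel

/-- As x → x₀, the indicators of `Iic x` converge except possibly at x₀, a null set; dominated
convergence applies. -/
theorem continuous_setIntegral_Iic {ν : Measure (Icc a b)} [NullSingletonClass ν] {ρ : Icc a b → E}
    (hρ : Integrable ρ ν) : Continuous fun x : Icc a b => ∫ s in Iic x, ρ s ∂ν := by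
  simp_rw [← integral_indicator (f := ρ) (μ := ν) measurableSet_Iic]
  rw [continuous_iff_continuousAt]
  intro x₀
  refine tendsto_integral_filter_of_dominated_convergence (fun s => ‖ρ s‖)
    (Filter.Eventually.of_forall fun x =>
      (hρ.indicator measurableSet_Iic).aestronglyMeasurable)
    (Filter.Eventually.of_forall fun x => Filter.Eventually.of_forall fun s =>
      norm_indicator_le_norm_self _ _) hρ.norm ?_
  filter_upwards [compl_mem_ae_iff.2 (measure_singleton (μ := ν) x₀)] with s hs
  refine tendsto_const_nhds.congr' ?_
  rcases lt_or_gt_of_ne hs with hlt | hgt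
  · filter_upwards [lt_mem_nhds hlt] with x hx
    rw [indicator_of_mem (show s ∈ Iic x₀ from hlt.le), indicator_of_mem (show s ∈ Iic x from hx.le)]
  · filter_upwards [gt_mem_nhds hgt] with x hx
    rw [indicator_of_notMem (show s ∉ Iic x₀ from not_le.2 hgt),
      indicator_of_notMem (show s ∉ Iic x from not_le.2 hx)]

theorem Continuous.integrable_clm_apply {ν : Measure (Icc a b)} [IsFiniteMeasure ν]
    {Φ : Icc a b → E →L[ℝ] F} (hΦ : Continuous Φ) {ρ : Icc a b → E} (hρ : Integrable ρ ν) : Integrable (fun t => Φ t (ρ t)) ν := by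
  obtain ⟨C, hC⟩ := isCompact_univ.exists_bound_of_continuousOn hΦ.continuousOn
  refine (hρ.norm.const_mul C).mono' ?_ (Filter.Eventually.of_forall fun t =>
    (Φ t).le_of_opNorm_le (hC t (mem_univ t)) _)
  exact (ContinuousLinearMap.id ℝ (E →L[ℝ] F)).aestronglyMeasurable_comp₂
    hΦ.aestronglyMeasurable hρ.aestronglyMeasurable

variable [hab : Fact (a < b)]

theorem setIntegral_Iic_leftPt {ν : Measure (Icc a b)} [NullSingletonClass ν] (ρ : Icc a b → E) :
    ∫ s in Iic (leftPt a b), ρ s ∂ν = 0 := by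
  refine setIntegral_measure_zero _ ?_
  have : Iic (leftPt a b) ⊆ {leftPt a b} := fun x hx => le_antisymm hx x.2.1
  exact measure_mono_null this (measure_singleton _)

/-- `f x = f a + ∫_{[a,x]} ρ dν` for all `x`. -/
structure HasBVDensity (f : Icc a b → E) (ν : Measure (Icc a b)) (ρ : Icc a b → E) : Prop where
  integrable : Integrable ρ ν
  eq_add : ∀ x, f x = f (leftPt a b) + ∫ s in Iic x, ρ s ∂ν

namespace HasBVDensity

variable {ν : Measure (Icc a b)} {f g : Icc a b → E} {ρ σ : Icc a b → E}

theorem sub_eq (h : HasBVDensity f ν ρ) {s t : Icc a b} (hst : s ≤ t) :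
    f t - f s = ∫ r in Ioc s t, ρ r ∂ν := by
  rw [h.eq_add t, h.eq_add s, ← setIntegral_Iic_sub_Iic h.integrable hst]; abel

protected theorem continuous [NullSingletonClass ν] (h : HasBVDensity f ν ρ) : Continuous f := by
  rw [funext h.eq_add]
  exact continuous_const.add (continuous_setIntegral_Iic h.integrable)

theorem isBVDeriv [CompleteSpace E] [IsFiniteMeasure ν] [NullSingletonClass ν] (h : HasBVDensity f ν ρ) :
    IsBVDeriv f (ν.withDensityᵥ ρ) := by
  have hd : HasDensity (ν.withDensityᵥ ρ) := ⟨ν, ρ, inferInstance, h.integrable, rfl⟩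
  refine ⟨hd, (isNonAtomic_iff hd).2 fun x => ?_, fun x => ?_⟩
  · rw [withDensityᵥ_apply h.integrable (measurableSet_singleton x)]
    exact setIntegral_measure_zero _ (measure_singleton x)
  · rw [withDensityᵥ_apply h.integrable measurableSet_Iic, ← h.eq_add]

theorem sub (hf : HasBVDensity f ν ρ) (hg : HasBVDensity g ν σ) :
    HasBVDensity (fun t => f t - g t) ν (fun t => ρ t - σ t) := by
  refine ⟨hf.integrable.sub hg.integrable, fun x => ?_⟩
  rw [integral_sub hf.integrable.integrableOn hg.integrable.integrableOn, hf.eq_add x, hg.eq_add x]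
  abel

theorem prodMk [CompleteSpace E] [CompleteSpace F] (hf : HasBVDensity f ν ρ) {u τ : Icc a b → F}
    (hu : HasBVDensity u ν τ) :
    HasBVDensity (fun t => (f t, u t)) ν (fun t => (ρ t, τ t)) := by
  refine ⟨hf.integrable.prodMk hu.integrable, fun x => ?_⟩
  rw [integral_pair hf.integrable.integrableOn hu.integrable.integrableOn, hf.eq_add x, hu.eq_add x]
  rfl

theorem clm_comp [CompleteSpace E] [CompleteSpace F] (hf : HasBVDensity f ν ρ) (L : E →L[ℝ] F) :
    HasBVDensity (fun t => L (f t)) ν (fun t => L (ρ t)) := by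
  refine ⟨L.integrable_comp hf.integrable, fun x => ?_⟩
  rw [L.integral_comp_comm hf.integrable.integrableOn, hf.eq_add x, map_add]

/-- Multiplying the density by dν/dν' allows a change to a larger measure, and so a common measure
for several functions. -/
theorem exists_of_le [CompleteSpace E] {ν' : Measure (Icc a b)} [IsFiniteMeasure ν]
    [IsFiniteMeasure ν'] (hf : HasBVDensity f ν ρ) (hle : ν ≤ ν') :
    ∃ ρ', HasBVDensity f ν' ρ' := by
  obtain ⟨ρ', hρ', e⟩ := HasDensity.of_le hle hf.integrable
  refine ⟨ρ', hρ', fun x => ?_⟩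
  rw [← withDensityᵥ_apply hρ' measurableSet_Iic, ← e,
    withDensityᵥ_apply hf.integrable measurableSet_Iic, ← hf.eq_add]

/-- The chain rule for `BV`-functions. -/
theorem comp [CompleteSpace E] [CompleteSpace F] [IsFiniteMeasure ν] [NullSingletonClass ν]
    (hf : HasBVDensity f ν ρ) {S : Set E} (hS : ∀ t, f t ∈ S) {φ : E → F} {φ' : E → E →L[ℝ] F}
    (hφ' : ContinuousOn φ' S) (hφ : ∀ x ∈ S, HasFDerivWithinAt φ (φ' x) S x) :
    HasBVDensity (fun t => φ (f t)) ν (fun t => φ' (f t) (ρ t)) := by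
  have hfc := hf.continuous
  have hΦ : Continuous fun t => φ' (f t) := hφ'.comp_continuous hfc hS
  have hint := hΦ.integrable_clm_apply hf.integrable
  have hφc : Continuous fun t => φ (f t) :=
    ContinuousOn.comp_continuous (fun x hx => (hφ x hx).continuousWithinAt) hfc hS
  refine ⟨hint, fun x => ?_⟩
  -- `G` is the defect in the chain rule. No differentiation theorem for ν is needed: `G` is
  -- compared with the increasing function `m`, which controls the increments of `f`.
  set G : Icc a b → F := fun t =>
    φ (f t) - φ (f (leftPt a b)) - ∫ s in Iic t, φ' (f s) (ρ s) ∂ν with hG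
  set m : Icc a b → ℝ := fun t => ∫ s in Iic t, ‖ρ s‖ ∂ν with hm
  have hGc : Continuous G := (hφc.sub continuous_const).sub (continuous_setIntegral_Iic hint)
  have hmc : Continuous m := continuous_setIntegral_Iic hf.integrable.norm
  have key : ∀ ε > 0, ‖G x‖ ≤ ε * m x := by
    intro ε hε
    have : Inhabited (Icc a b) := ⟨leftPt a b⟩
    have hclosed : IsClosed {t | ‖G t‖ ≤ ε * m t} :=
      isClosed_le hGc.norm (continuous_const.mul hmc)
    -- Continuous induction: the closed set where ‖G‖ ≤ εm contains the left endpoint and extends to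
    -- the right of each of its points.
    have hsub := IsClosed.Icc_subset_of_forall_mem_nhdsWithin (a := leftPt a b) (b := x)
      (s := {t | ‖G t‖ ≤ ε * m t}) (hclosed.inter isClosed_Icc) ?_ ?_
    · exact hsub ⟨x.2.1, le_rfl⟩
    · simp [hG, hm, setIntegral_Iic_leftPt]
    · rintro t ⟨ht, -⟩
      have h1 : ∀ᶠ s in 𝓝 t, ‖φ (f s) - φ (f t) - φ' (f t) (f s - f t)‖ ≤
          ε / 2 * ‖f s - f t‖ := by
        have ho := ((hφ (f t) (hS t)).isLittleO).def (half_pos hε)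
        exact (tendsto_nhdsWithin_iff.2 ⟨hfc.continuousAt,
          Filter.Eventually.of_forall hS⟩ : Filter.Tendsto f (𝓝 t) (𝓝[S] (f t))).eventually ho
      obtain ⟨δ, hδ, h2⟩ := Metric.continuousAt_iff.1 hΦ.continuousAt (ε / 2) (half_pos hε)
      filter_upwards [self_mem_nhdsWithin, mem_nhdsWithin_of_mem_nhds h1,
        mem_nhdsWithin_of_mem_nhds (Metric.ball_mem_nhds t hδ)] with s hts h1s hsδ
      have hle : t ≤ s := le_of_lt hts
      have hm_sub : m s - m t = ∫ r in Ioc t s, ‖ρ r‖ ∂ν :=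
        setIntegral_Iic_sub_Iic hf.integrable.norm hle
      have hf_le : ‖f s - f t‖ ≤ m s - m t := by
        rw [hf.sub_eq hle, hm_sub]; exact norm_integral_le_integral_norm _
      -- Inserting φ'(f t) splits the increment into a Taylor remainder of φ and the oscillation of
      -- φ' ∘ f on (t,s], each at most ε/2 times the increment of `m`.
      have hG_sub : G s - G t = (φ (f s) - φ (f t) - φ' (f t) (f s - f t)) -
          ∫ r in Ioc t s, (φ' (f r) - φ' (f t)) (ρ r) ∂ν := by
        have e1 := setIntegral_Iic_sub_Iic hint hle
        have e2 : ∫ r in Ioc t s, (φ' (f r) - φ' (f t)) (ρ r) ∂ν =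
            (∫ r in Ioc t s, φ' (f r) (ρ r) ∂ν) - φ' (f t) (f s - f t) := by
          rw [hf.sub_eq hle, ← ContinuousLinearMap.integral_comp_comm _
            hf.integrable.integrableOn, ← integral_sub hint.integrableOn
            ((φ' (f t)).integrable_comp hf.integrable).integrableOn]
          rfl
        rw [e2, ← e1]; simp only [hG]; abel
      have h3 : ‖∫ r in Ioc t s, (φ' (f r) - φ' (f t)) (ρ r) ∂ν‖ ≤ ε / 2 * (m s - m t) := by
        rw [hm_sub, ← integral_const_mul]
        refine norm_integral_le_of_norm_le (hf.integrable.norm.const_mul _).integrableOn ?_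
        refine (ae_restrict_mem measurableSet_Ioc).mono fun r hr => ?_
        refine ContinuousLinearMap.le_of_opNorm_le _ ?_ _
        rw [← dist_eq_norm]
        refine (h2 (lt_of_le_of_lt ?_ hsδ)).le
        have hr1 : (t : ℝ) ≤ r := hr.1.le
        have hr2 : (r : ℝ) ≤ s := hr.2
        rw [Subtype.dist_eq, Subtype.dist_eq, Real.dist_eq, Real.dist_eq,
          abs_of_nonneg (by linarith), abs_of_nonneg (by linarith)]
        linarith
      have h4 : ‖G s - G t‖ ≤ ε * (m s - m t) := by
        rw [hG_sub]
        refine (norm_sub_le _ _).trans ?_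
        have : ε / 2 * ‖f s - f t‖ ≤ ε / 2 * (m s - m t) := by gcongr
        linarith
      have h5 := norm_le_norm_add_norm_sub' (G s) (G t)
      have ht' : ‖G t‖ ≤ ε * m t := ht
      change ‖G s‖ ≤ ε * m s
      linarith
  have hm0 : 0 ≤ m x := integral_nonneg fun _ => norm_nonneg _
  have hG0 : ‖G x‖ ≤ 0 := by
    refine le_of_forall_pos_le_add fun ε hε => ?_
    have := key (ε / (m x + 1)) (by positivity)
    refine this.trans ?_
    rw [zero_add, div_mul_eq_mul_div, div_le_iff₀ (by positivity)]
    nlinarith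
  have := norm_le_zero_iff.1 hG0
  simp only [hG, sub_sub, sub_eq_zero] at this
  exact this

end HasBVDensity

/-! ### `BV`-functions -/

namespace BV

variable [CompleteSpace E] [CompleteSpace F]

theorem ext {f g : BV a b E} (h : ∀ t, f t = g t) : f = g := Subtype.ext (funext h)

@[simp] theorem add_apply (f g : BV a b E) (t : Icc a b) : (f + g) t = f t + g t := rfl

@[simp] theorem sub_apply (f g : BV a b E) (t : Icc a b) : (f - g) t = f t - g t := rfl

@[simp] theorem smul_apply (c : ℝ) (f : BV a b E) (t : Icc a b) : (c • f) t = c • f t := rfl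

/-- A function in `bvFunctions a b E`, as an element of `BV a b E`. -/
def ofMem (f : Icc a b → E) (h : f ∈ bvFunctions a b E) : BV a b E := ⟨f, h⟩

@[simp] theorem ofMem_apply (f : Icc a b → E) (h : f ∈ bvFunctions a b E) (t : Icc a b) :
    ofMem f h t = f t := rfl

theorem mem_bvFunctions {f : Icc a b → E} {ν : Measure (Icc a b)} [IsFiniteMeasure ν]
    [NullSingletonClass ν] {ρ : Icc a b → E} (h : HasBVDensity f ν ρ) : f ∈ bvFunctions a b E :=
  ⟨_, h.isBVDeriv⟩

/-- Non-atomicity only says ν{x}ρ(x) = 0, so ν may charge points where ρ vanishes. Restricting ν to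
{ρ ≠ 0} removes these masses without changing ρ dν. -/
theorem exists_hasBVDensity (f : BV a b E) : ∃ (ν : Measure (Icc a b)) (ρ : Icc a b → E),
    IsFiniteMeasure ν ∧ NullSingletonClass ν ∧ HasBVDensity f ν ρ := by
  obtain ⟨⟨ν, ρ₀, hν, hρ₀, e₀⟩, hna, heq⟩ := f.isBVDeriv_deriv
  -- A strongly measurable representative makes {ρ ≠ 0} measurable.
  obtain ⟨ρ, hρm, hae⟩ := hρ₀.aestronglyMeasurable
  have hρ : Integrable ρ ν := hρ₀.congr hae
  have e : f.deriv = ν.withDensityᵥ ρ := e₀.trans (WithDensityᵥEq.congr_ae hae)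
  have hpt := (isNonAtomic_iff f.isBVDeriv_deriv.hasDensity).1 hna
  have hs : MeasurableSet {x | ρ x ≠ 0} :=
    (hρm.measurableSet_eq_fun stronglyMeasurable_const).compl
  refine ⟨ν.restrict {x | ρ x ≠ 0}, ρ, inferInstance, ⟨fun x => ?_⟩, hρ.restrict, fun x => ?_⟩
  · rw [Measure.restrict_apply (measurableSet_singleton x)]
    by_cases hx : ρ x = 0
    · have : ({x} ∩ {x | ρ x ≠ 0} : Set (Icc a b)) = ∅ := by ext y; simp; rintro rfl; exact hx
      rw [this, measure_empty]
    · have h0 : ν.real {x} • ρ x = 0 := by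
        rw [← integral_singleton, ← withDensityᵥ_apply hρ (measurableSet_singleton x), ← e]
        exact hpt x
      have := (smul_eq_zero.1 h0).resolve_right hx
      exact measure_mono_null inter_subset_left ((measureReal_eq_zero_iff (by finiteness)).1 this)
  · rw [heq x, e, withDensityᵥ_apply hρ measurableSet_Iic, Measure.restrict_restrict measurableSet_Iic,
      inter_comm, ← Measure.restrict_restrict hs, ← integral_indicator hs]
    congr 2
    ext y
    by_cases hy : ρ y = 0 <;> simp [indicator, hy]

theorem exists_hasBVDensity₂ (f : BV a b E) (g : BV a b F) :
    ∃ (ν : Measure (Icc a b)) (ρ : Icc a b → E) (σ : Icc a b → F),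
    IsFiniteMeasure ν ∧ NullSingletonClass ν ∧ HasBVDensity f ν ρ ∧ HasBVDensity g ν σ := by
  obtain ⟨ν₁, ρ, h₁, h₁', hf⟩ := f.exists_hasBVDensity
  obtain ⟨ν₂, σ, h₂, h₂', hg⟩ := g.exists_hasBVDensity
  obtain ⟨ρ', hf'⟩ := hf.exists_of_le (ν' := ν₁ + ν₂) (Measure.le_add_right le_rfl)
  obtain ⟨σ', hg'⟩ := hg.exists_of_le (ν' := ν₁ + ν₂) (Measure.le_add_left le_rfl)
  exact ⟨ν₁ + ν₂, ρ', σ', inferInstance, ⟨fun x => by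
    simp [measure_singleton]⟩, hf', hg'⟩

protected theorem continuous (f : BV a b E) : Continuous (f : Icc a b → E) := by
  obtain ⟨ν, ρ, _, _, hf⟩ := f.exists_hasBVDensity
  exact hf.continuous

/-- The variation of ρ dν is ‖ρ‖ dν. Every norm estimate below thereby becomes an L¹-estimate of
densities. -/
theorem norm_eq_of_hasBVDensity {f : BV a b E} {ν : Measure (Icc a b)} [IsFiniteMeasure ν]
    [NullSingletonClass ν] {ρ : Icc a b → E} (h : HasBVDensity f ν ρ) :
    ‖f‖ = ‖f (leftPt a b)‖ + ∫ t, ‖ρ t‖ ∂ν := by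
  rw [norm_def, f.isBVDeriv_deriv.unique h.isBVDeriv, Measure.variation_withDensityᵥ h.integrable,
    withDensity_apply _ MeasurableSet.univ, setLIntegral_univ,
    integral_norm_eq_lintegral_enorm h.integrable.aestronglyMeasurable]

theorem norm_apply_le (f : BV a b E) (t : Icc a b) : ‖f t‖ ≤ ‖f‖ := by
  obtain ⟨ν, ρ, _, _, hf⟩ := f.exists_hasBVDensity
  rw [norm_eq_of_hasBVDensity hf, hf.eq_add t]
  refine (norm_add_le _ _).trans (add_le_add le_rfl ((norm_integral_le_integral_norm _).trans ?_))
  exact setIntegral_le_integral hf.integrable.norm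
    (Filter.Eventually.of_forall fun _ => norm_nonneg _)

theorem isCompact_range (f : BV a b E) : IsCompact (range (f : Icc a b → E)) :=
  _root_.isCompact_range f.continuous

/-- The compact image of f has a thickening inside `U`, and BV-close functions are uniformly close.
-/
theorem isOpen_inside {U : Set E} (hU : IsOpen U) : IsOpen (inside a b U) := by
  rw [Metric.isOpen_iff]
  intro f hf
  obtain ⟨δ, hδ, h⟩ := f.isCompact_range.exists_thickening_subset_open hU (range_subset_iff.2 hf)
  refine ⟨δ, hδ, fun g hg t => h ?_⟩
  rw [Metric.mem_thickening_iff]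
  refine ⟨f t, mem_range_self t, ?_⟩
  rw [dist_eq_norm, ← sub_apply]
  rw [Metric.mem_ball, dist_eq_norm] at hg
  exact (norm_apply_le _ t).trans_lt hg

theorem clm_comp_mem (L : E →L[ℝ] F) (f : BV a b E) :
    (fun t => L (f t)) ∈ bvFunctions a b F := by
  obtain ⟨ν, ρ, _, _, hf⟩ := f.exists_hasBVDensity
  exact mem_bvFunctions (hf.clm_comp L)

/-- Composition with a continuous linear map. -/
noncomputable def mapCLM (L : E →L[ℝ] F) : BV a b E →L[ℝ] BV a b F :=
  LinearMap.mkContinuous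
    { toFun := fun f => ofMem _ (clm_comp_mem L f)
      map_add' := fun f g => ext fun t => by simp
      map_smul' := fun c f => ext fun t => by simp } ‖L‖ fun f => by
    obtain ⟨ν, ρ, _, _, hf⟩ := f.exists_hasBVDensity
    have hg : HasBVDensity (ofMem _ (clm_comp_mem L f)) ν _ := hf.clm_comp L
    change ‖ofMem _ (clm_comp_mem L f)‖ ≤ _
    rw [norm_eq_of_hasBVDensity hg, norm_eq_of_hasBVDensity hf, mul_add, ← integral_const_mul]
    exact add_le_add (L.le_opNorm _) (integral_mono hg.integrable.norm
      (hf.integrable.norm.const_mul _) fun t => L.le_opNorm _)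

@[simp] theorem mapCLM_apply (L : E →L[ℝ] F) (f : BV a b E) (t : Icc a b) :
    mapCLM L f t = L (f t) := rfl

end BV

/-- The product rule, as the chain rule for the bounded bilinear evaluation map. -/
theorem HasBVDensity.clm_apply [CompleteSpace E] [CompleteSpace F] {ν : Measure (Icc a b)}
    [IsFiniteMeasure ν] [NullSingletonClass ν] {Φ P : Icc a b → E →L[ℝ] F} {f ρ : Icc a b → E}
    (hΦ : HasBVDensity Φ ν P) (hf : HasBVDensity f ν ρ) :
    HasBVDensity (fun t => Φ t (f t)) ν (fun t => Φ t (ρ t) + P t (f t)) := by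
  have hb := isBoundedBilinearMap_apply (𝕜 := ℝ) (E := E) (F := F)
  have := (hΦ.prodMk hf).comp (S := univ) (fun _ => mem_univ _)
    (φ := fun p : (E →L[ℝ] F) × E => p.1 p.2) (φ' := fun p => hb.deriv p)
    hb.isBoundedLinearMap_deriv.continuous.continuousOn
    fun p _ => (hb.hasFDerivAt p).hasFDerivWithinAt
  simpa using this

namespace BV

variable [CompleteSpace E] [CompleteSpace F]

theorem clm_apply_mem (Φ : BV a b (E →L[ℝ] F)) (f : BV a b E) :
    (fun t => Φ t (f t)) ∈ bvFunctions a b F := by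
  obtain ⟨ν, P, ρ, _, _, hΦ, hf⟩ := exists_hasBVDensity₂ Φ f
  exact mem_bvFunctions (hΦ.clm_apply hf)

/-- The pointwise evaluation of operator-valued `BV`-functions at vector-valued ones. -/
noncomputable def clmApply :
    BV a b (E →L[ℝ] F) →L[ℝ] BV a b E →L[ℝ] BV a b F :=
  LinearMap.mkContinuous₂
    (LinearMap.mk₂ ℝ (fun Φ f => ofMem _ (clm_apply_mem Φ f))
      (fun Φ Ψ f => ext fun t => by simp)
      (fun c Φ f => ext fun t => by simp)
      (fun Φ f g => ext fun t => by simp)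
      -- The initial value and the term Φρ together contribute ‖Φ‖‖f‖; the term Pf contributes
      -- another ‖Φ‖‖f‖.
      (fun c Φ f => ext fun t => by simp)) 2 fun Φ f => by
    obtain ⟨ν, P, ρ, _, _, hΦ, hf⟩ := exists_hasBVDensity₂ Φ f
    have hg : HasBVDensity (ofMem _ (clm_apply_mem Φ f)) ν _ := hΦ.clm_apply hf
    change ‖ofMem _ (clm_apply_mem Φ f)‖ ≤ _
    have h1 : ∫ t, ‖Φ t (ρ t) + P t (f t)‖ ∂ν ≤
        ‖Φ‖ * (∫ t, ‖ρ t‖ ∂ν) + (∫ t, ‖P t‖ ∂ν) * ‖f‖ := by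
      rw [← integral_const_mul, ← integral_mul_const,
        ← integral_add (hf.integrable.norm.const_mul _) (hΦ.integrable.norm.mul_const _)]
      refine integral_mono hg.integrable.norm
        ((hf.integrable.norm.const_mul _).add (hΦ.integrable.norm.mul_const _)) fun t => ?_
      refine (norm_add_le _ _).trans (add_le_add ?_ ?_)
      · exact (Φ t).le_of_opNorm_le (norm_apply_le Φ t) _
      · exact (P t).le_opNorm_of_le (norm_apply_le f t)
    have h2 : ‖Φ (leftPt a b) (f (leftPt a b))‖ ≤ ‖Φ‖ * ‖f (leftPt a b)‖ :=
      (Φ _).le_of_opNorm_le (norm_apply_le Φ _) _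
    rw [norm_eq_of_hasBVDensity hg, ofMem_apply]
    have h3 := norm_eq_of_hasBVDensity hf
    have h4 : ∫ t, ‖P t‖ ∂ν ≤ ‖Φ‖ := by
      rw [norm_eq_of_hasBVDensity hΦ]; linarith [norm_nonneg (Φ (leftPt a b))]
    have h5 : (∫ t, ‖P t‖ ∂ν) * ‖f‖ ≤ ‖Φ‖ * ‖f‖ := by gcongr
    have h6 : ‖Φ‖ * ‖f‖ = ‖Φ‖ * ‖f (leftPt a b)‖ + ‖Φ‖ * ∫ t, ‖ρ t‖ ∂ν := by rw [h3, mul_add]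
    linarith

@[simp] theorem clmApply_apply (Φ : BV a b (E →L[ℝ] F)) (f : BV a b E) (t : Icc a b) :
    clmApply Φ f t = Φ t (f t) := rfl

end BV

end BVDensity

/-! ### Uniform estimates near compact sets -/

section Compact

variable {E F : Type*} [NormedAddCommGroup E] [NormedAddCommGroup F] {K S : Set E}

/-- A Lebesgue number of the cover by the given balls serves as a uniform δ. -/
theorem IsCompact.exists_pos_forall_of_locally (hK : IsCompact K) (hKS : K ⊆ S) {R : E → E → Prop}
    (h : ∀ x ∈ K, ∃ r > 0, ∀ y ∈ S ∩ Metric.ball x r, ∀ z ∈ S ∩ Metric.ball x r, R y z) :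
    ∃ δ > 0, ∀ y ∈ K, ∀ z ∈ S, ‖z - y‖ < δ → R y z := by
  choose r hr hR using h
  obtain ⟨δ, hδ, hball⟩ := lebesgue_number_lemma_of_metric hK
    (c := fun x : K => Metric.ball (x : E) (r x x.2)) (fun _ => Metric.isOpen_ball)
    fun x hx => mem_iUnion.2 ⟨⟨x, hx⟩, Metric.mem_ball_self (hr x hx)⟩
  refine ⟨δ, hδ, fun y hy z hz hzy => ?_⟩
  obtain ⟨⟨x, hx⟩, hsub⟩ := hball y hy
  exact hR x hx y ⟨hKS hy, hsub (Metric.mem_ball_self hδ)⟩ z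
    ⟨hz, hsub (by rwa [Metric.mem_ball, dist_eq_norm])⟩

theorem ContinuousOn.exists_pos_norm_sub_le (hK : IsCompact K) (hKS : K ⊆ S) {q : E → F}
    (hq : ContinuousOn q S) {ε : ℝ} (hε : 0 < ε) :
    ∃ δ > 0, ∀ y ∈ K, ∀ z ∈ S, ‖z - y‖ < δ → ‖q z - q y‖ ≤ ε := by
  refine hK.exists_pos_forall_of_locally hKS fun x hx => ?_
  obtain ⟨r, hr, h⟩ := Metric.continuousWithinAt_iff.1 (hq x (hKS hx)) (ε / 2) (half_pos hε)
  refine ⟨r, hr, fun y hy z hz => ?_⟩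
  rw [← dist_eq_norm]
  have := dist_triangle_right (q z) (q y) (q x)
  linarith [h hy.1 hy.2, h hz.1 hz.2]

/-- On a small convex piece of `S`, φ' oscillates by at most ε, so the mean value inequality
applies; compactness of `K` makes the radius uniform. -/
theorem exists_pos_norm_sub_sub_le [NormedSpace ℝ E] [NormedSpace ℝ F] (hK : IsCompact K) (hKS : K ⊆ S)
    (hconv : ∀ x ∈ S, ∃ r > 0, Convex ℝ (S ∩ Metric.ball x r)) {φ : E → F} {φ' : E → E →L[ℝ] F}
    (hφ' : ContinuousOn φ' S) (hφ : ∀ x ∈ S, HasFDerivWithinAt φ (φ' x) S x) {ε : ℝ} (hε : 0 < ε) :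
    ∃ δ > 0, ∀ y ∈ K, ∀ z ∈ S, ‖z - y‖ < δ → ‖φ z - φ y - φ' y (z - y)‖ ≤ ε * ‖z - y‖ := by
  refine hK.exists_pos_forall_of_locally hKS fun x hx => ?_
  obtain ⟨r, hr, h⟩ := Metric.continuousWithinAt_iff.1 (hφ' x (hKS hx)) (ε / 2) (half_pos hε)
  obtain ⟨r', hr', hc⟩ := hconv x (hKS hx)
  have hc' : Convex ℝ (S ∩ Metric.ball x (min r r')) := by
    have : S ∩ Metric.ball x (min r r') = (S ∩ Metric.ball x r') ∩ Metric.ball x r := by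
      ext z; simp only [mem_inter_iff, Metric.mem_ball, lt_min_iff]; tauto
    rw [this]
    exact hc.inter (convex_ball x r)
  refine ⟨min r r', lt_min hr hr', fun y hy z hz => ?_⟩
  refine hc'.norm_image_sub_le_of_norm_hasFDerivWithin_le'
    (fun w hw => (hφ w hw.1).mono inter_subset_left) (fun w hw => ?_) hy hz
  have hlt : ∀ w ∈ S ∩ Metric.ball x (min r r'), dist (φ' w) (φ' x) < ε / 2 := fun w hw =>
    h hw.1 (lt_of_lt_of_le hw.2 (min_le_left _ _))
  rw [← dist_eq_norm]
  have := dist_triangle_right (φ' w) (φ' y) (φ' x)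
  linarith [hlt w hw, hlt y hy]

end Compact

/-! ### Composition of `BV`-functions with differentiable maps -/

namespace BV

section Postcomp

variable {a b : ℝ} [hab : Fact (a < b)]
  {E : Type*} [NormedAddCommGroup E] [NormedSpace ℝ E] [CompleteSpace E]
  {F : Type*} [NormedAddCommGroup F] [NormedSpace ℝ F] [CompleteSpace F]
  {S : Set E} {φ : E → F} {φ' : E → E →L[ℝ] F}

open Classical in
/-- The composition `φ ∘ f` as a `BV`-function (and `0` if it is not a `BV`-function). -/
noncomputable def postcomp (φ : E → F) (f : BV a b E) : BV a b F :=
  if h : (fun t => φ (f t)) ∈ bvFunctions a b F then ofMem _ h else 0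

theorem postcomp_apply (hφ' : ContinuousOn φ' S) (hφ : ∀ x ∈ S, HasFDerivWithinAt φ (φ' x) S x)
    {f : BV a b E} (hf : f ∈ inside a b S) (t : Icc a b) : postcomp φ f t = φ (f t) := by
  obtain ⟨ν, ρ, _, _, hρ⟩ := f.exists_hasBVDensity
  rw [postcomp, dif_pos (mem_bvFunctions (hρ.comp hf hφ' hφ)), ofMem_apply]

theorem hasBVDensity_postcomp (hφ' : ContinuousOn φ' S)
    (hφ : ∀ x ∈ S, HasFDerivWithinAt φ (φ' x) S x) {f : BV a b E} (hf : f ∈ inside a b S)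
    {ν : Measure (Icc a b)} [IsFiniteMeasure ν] [NullSingletonClass ν] {ρ : Icc a b → E}
    (hρ : HasBVDensity f ν ρ) :
    HasBVDensity (postcomp φ f) ν (fun t => φ' (f t) (ρ t)) := by
  have := hρ.comp hf hφ' hφ
  rwa [← funext (postcomp_apply hφ' hφ hf)] at this

theorem continuousOn_postcomp (hφ' : ContinuousOn φ' S)
    (hφ : ∀ x ∈ S, HasFDerivWithinAt φ (φ' x) S x) :
    ContinuousOn (postcomp φ : BV a b E → BV a b F) (inside a b S) := by
  rw [Metric.continuousOn_iff]
  intro f hf ε hε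
  have hKS : range f ⊆ S := range_subset_iff.2 hf
  have hφc : ContinuousOn φ S := fun x hx => (hφ x hx).continuousWithinAt
  obtain ⟨C, hC⟩ := f.isCompact_range.exists_bound_of_continuousOn (hφ'.mono hKS)
  have hC0 : 0 ≤ C := (norm_nonneg _).trans (hC _ (mem_range_self (leftPt a b)))
  -- The final bound is η + η‖f‖ + ε/4 = 3ε/4 < ε.
  set η : ℝ := ε / (2 * (‖f‖ + 1)) with hη
  have hη0 : 0 < η := by positivity
  obtain ⟨δ₁, hδ₁, h₁⟩ := hφc.exists_pos_norm_sub_le f.isCompact_range hKS hη0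
  obtain ⟨δ₂, hδ₂, h₂⟩ := hφ'.exists_pos_norm_sub_le f.isCompact_range hKS hη0
  refine ⟨min (min δ₁ δ₂) (ε / (4 * (C + η + 1))), by positivity, fun g hg hgf => ?_⟩
  rw [dist_eq_norm] at hgf ⊢
  obtain ⟨ν, ρ, σ, _, _, hρ, hσ⟩ := exists_hasBVDensity₂ f g
  have hd := (hasBVDensity_postcomp hφ' hφ hg hσ).sub (hasBVDensity_postcomp hφ' hφ hf hρ)
  have hd' : HasBVDensity (postcomp φ g - postcomp φ f : BV a b F) ν _ := hd
  have hgf' : HasBVDensity (g - f : BV a b E) ν _ := hσ.sub hρ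
  rw [norm_eq_of_hasBVDensity hd', sub_apply, postcomp_apply hφ' hφ hg, postcomp_apply hφ' hφ hf]
  have hpt : ∀ t, ‖g t - f t‖ ≤ ‖g - f‖ := fun t => norm_apply_le (g - f) t
  have hφ'g : ∀ t, ‖φ' (g t) - φ' (f t)‖ ≤ η := fun t => h₂ _ (mem_range_self t) _ (hg t)
    ((hpt t).trans_lt (hgf.trans_le ((min_le_left _ _).trans (min_le_right _ _))))
  have hA : ‖φ (g (leftPt a b)) - φ (f (leftPt a b))‖ ≤ η := h₁ _ (mem_range_self _) _ (hg _)
    ((hpt _).trans_lt (hgf.trans_le ((min_le_left _ _).trans (min_le_left _ _))))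
  have hB : ∫ t, ‖φ' (g t) (σ t) - φ' (f t) (ρ t)‖ ∂ν ≤
      (C + η) * (∫ t, ‖σ t - ρ t‖ ∂ν) + η * ∫ t, ‖ρ t‖ ∂ν := by
    rw [← integral_const_mul, ← integral_const_mul,
      ← integral_add (hgf'.integrable.norm.const_mul _) (hρ.integrable.norm.const_mul _)]
    refine integral_mono hd'.integrable.norm
      ((hgf'.integrable.norm.const_mul _).add (hρ.integrable.norm.const_mul _)) fun t => ?_
    -- The first summand is small in L¹ because σ - ρ is, the second because φ'(g) - φ'(f) is
    -- uniformly small.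
    have e : φ' (g t) (σ t) - φ' (f t) (ρ t) =
        φ' (g t) (σ t - ρ t) + (φ' (g t) - φ' (f t)) (ρ t) := by
      simp only [map_sub, _root_.sub_apply]; abel
    simp only [e]
    refine (norm_add_le _ _).trans (add_le_add ?_ ?_)
    · refine ContinuousLinearMap.le_of_opNorm_le _ ?_ _
      have := norm_le_norm_add_norm_sub' (φ' (g t)) (φ' (f t))
      linarith [hC _ (mem_range_self t), hφ'g t]
    · exact ContinuousLinearMap.le_of_opNorm_le _ (hφ'g t) _
  have h3 : ∫ t, ‖σ t - ρ t‖ ∂ν ≤ ‖g - f‖ := by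
    rw [norm_eq_of_hasBVDensity hgf']; linarith [norm_nonneg ((g - f : BV a b E) (leftPt a b))]
  have h4 : ∫ t, ‖ρ t‖ ∂ν ≤ ‖f‖ := by
    rw [norm_eq_of_hasBVDensity hρ]; linarith [norm_nonneg (f (leftPt a b))]
  have h5 : (C + η) * ∫ t, ‖σ t - ρ t‖ ∂ν ≤ ε / 4 := by
    have h6 : ∫ t, ‖σ t - ρ t‖ ∂ν ≤ ε / (4 * (C + η + 1)) :=
      h3.trans (hgf.le.trans (min_le_right _ _))
    calc (C + η) * ∫ t, ‖σ t - ρ t‖ ∂ν ≤ (C + η + 1) * (ε / (4 * (C + η + 1))) :=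
          mul_le_mul (by linarith) h6 (integral_nonneg fun _ => norm_nonneg _) (by linarith)
      _ = ε / 4 := by field_simp
  have h7 : η * ∫ t, ‖ρ t‖ ∂ν ≤ η * ‖f‖ := by gcongr
  have h8 : η * (‖f‖ + 1) = ε / 2 := by rw [hη]; field_simp
  linarith

/-- The remainder at the left endpoint is a Taylor remainder of φ. The density of the remainder
regroups into an increment of φ' applied to σ - ρ and a Taylor remainder of φ' applied to ρ, so the
whole is o(‖g - f‖). -/
theorem hasFDerivWithinAt_postcomp (hconv : ∀ x ∈ S, ∃ r > 0, Convex ℝ (S ∩ Metric.ball x r))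
    (hφ' : ContinuousOn φ' S) (hφ : ∀ x ∈ S, HasFDerivWithinAt φ (φ' x) S x)
    {φ'' : E → E →L[ℝ] E →L[ℝ] F} (hφ'' : ContinuousOn φ'' S)
    (hφ2 : ∀ x ∈ S, HasFDerivWithinAt φ' (φ'' x) S x)
    (hsymm : ∀ x ∈ S, ∀ u v, φ'' x u v = φ'' x v u) {f : BV a b E} (hf : f ∈ inside a b S) :
    HasFDerivWithinAt (postcomp φ) (clmApply (postcomp φ' f)) (inside a b S) f := by
  rw [hasFDerivWithinAt_iff_isLittleO, Asymptotics.isLittleO_iff]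
  intro c hc
  have hKS : range f ⊆ S := range_subset_iff.2 hf
  -- The three contributions are η, η and η‖f‖, each times ‖g - f‖.
  set η : ℝ := c / (2 + ‖f‖) with hη
  have hη0 : 0 < η := by positivity
  obtain ⟨δ₁, hδ₁, h₁⟩ := exists_pos_norm_sub_sub_le f.isCompact_range hKS hconv hφ' hφ hη0
  obtain ⟨δ₂, hδ₂, h₂⟩ := exists_pos_norm_sub_sub_le f.isCompact_range hKS hconv hφ'' hφ2 hη0
  obtain ⟨δ₃, hδ₃, h₃⟩ := hφ'.exists_pos_norm_sub_le f.isCompact_range hKS hη0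
  filter_upwards [self_mem_nhdsWithin, mem_nhdsWithin_of_mem_nhds
    (Metric.ball_mem_nhds f (lt_min hδ₁ (lt_min hδ₂ hδ₃)))] with g hg hgf
  rw [Metric.mem_ball, dist_eq_norm, lt_min_iff, lt_min_iff] at hgf
  obtain ⟨ν, ρ, σ, _, _, hρ, hσ⟩ := exists_hasBVDensity₂ f g
  have hpt : ∀ t, ‖g t - f t‖ ≤ ‖g - f‖ := fun t => norm_apply_le (g - f) t
  have hgf' : HasBVDensity (g - f : BV a b E) ν _ := hσ.sub hρ
  have hM : HasBVDensity (clmApply (postcomp φ' f) (g - f)) ν _ :=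
    (hasBVDensity_postcomp hφ'' hφ2 hf hρ).clm_apply hgf'
  have hd : HasBVDensity
      (postcomp φ g - postcomp φ f - clmApply (postcomp φ' f) (g - f) : BV a b F) ν _ :=
    ((hasBVDensity_postcomp hφ' hφ hg hσ).sub (hasBVDensity_postcomp hφ' hφ hf hρ)).sub hM
  rw [norm_eq_of_hasBVDensity hd]
  have hA : ‖(postcomp φ g - postcomp φ f - clmApply (postcomp φ' f) (g - f) : BV a b F)
      (leftPt a b)‖ ≤ η * ‖g - f‖ := by
    simp only [sub_apply, clmApply_apply, postcomp_apply hφ' hφ hg, postcomp_apply hφ' hφ hf,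
      postcomp_apply hφ'' hφ2 hf]
    refine (h₁ _ (mem_range_self _) _ (hg _) ((hpt _).trans_lt hgf.1)).trans ?_
    gcongr
    exact hpt _
  have hB : ∫ t, ‖φ' (g t) (σ t) - φ' (f t) (ρ t) - ((postcomp φ' f) t (σ t - ρ t) +
      φ'' (f t) (ρ t) ((g - f : BV a b E) t))‖ ∂ν ≤
      η * (∫ t, ‖σ t - ρ t‖ ∂ν) + η * ‖g - f‖ * ∫ t, ‖ρ t‖ ∂ν := by
    rw [← integral_const_mul, ← integral_const_mul,
      ← integral_add (hgf'.integrable.norm.const_mul _) (hρ.integrable.norm.const_mul _)]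
    refine integral_mono hd.integrable.norm
      ((hgf'.integrable.norm.const_mul _).add (hρ.integrable.norm.const_mul _)) fun t => ?_
    -- The product rule yields φ''(f)(ρ)(g - f); symmetry swaps the arguments to form the Taylor
    -- remainder of φ'.
    have e : φ' (g t) (σ t) - φ' (f t) (ρ t) - ((postcomp φ' f) t (σ t - ρ t) +
        φ'' (f t) (ρ t) ((g - f : BV a b E) t)) =
        (φ' (g t) - φ' (f t)) (σ t - ρ t) +
          (φ' (g t) - φ' (f t) - φ'' (f t) (g t - f t)) (ρ t) := by
      rw [postcomp_apply hφ'' hφ2 hf, sub_apply, hsymm _ (hf t)]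
      simp only [map_sub, _root_.sub_apply]; abel
    simp only [e]
    refine (norm_add_le _ _).trans (add_le_add ?_ ?_)
    · exact ContinuousLinearMap.le_of_opNorm_le _
        (h₃ _ (mem_range_self t) _ (hg t) ((hpt t).trans_lt hgf.2.2)) _
    · refine ContinuousLinearMap.le_of_opNorm_le _
        ((h₂ _ (mem_range_self t) _ (hg t) ((hpt t).trans_lt hgf.2.1)).trans ?_) _
      gcongr
      exact hpt t
  have h5 : ∫ t, ‖σ t - ρ t‖ ∂ν ≤ ‖g - f‖ := by
    rw [norm_eq_of_hasBVDensity hgf']; linarith [norm_nonneg ((g - f : BV a b E) (leftPt a b))]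
  have h6 : ∫ t, ‖ρ t‖ ∂ν ≤ ‖f‖ := by
    rw [norm_eq_of_hasBVDensity hρ]; linarith [norm_nonneg (f (leftPt a b))]
  have h7 : η * (∫ t, ‖σ t - ρ t‖ ∂ν) ≤ η * ‖g - f‖ := by gcongr
  have h8 : η * ‖g - f‖ * ∫ t, ‖ρ t‖ ∂ν ≤ η * ‖g - f‖ * ‖f‖ := by gcongr
  have h9 : η * ‖g - f‖ + (η * ‖g - f‖ + η * ‖g - f‖ * ‖f‖) = c * ‖g - f‖ := by
    rw [hη]; field_simp; ring
  rw [← h9]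
  exact add_le_add hA (hB.trans (add_le_add h7 h8))

theorem contDiffOn_zero_postcomp (hS : UniqueDiffOn ℝ S) (hφ : ContDiffOn ℝ 1 φ S) :
    ContDiffOn ℝ 0 (postcomp φ : BV a b E → BV a b F) (inside a b S) :=
  contDiffOn_zero.2 (continuousOn_postcomp (hφ.continuousOn_fderivWithin hS le_rfl)
    fun x hx => (hφ.differentiableOn one_ne_zero x hx).hasFDerivWithinAt)

/-- Induction step: the derivative is a continuous linear map applied to the pushforward by φ'.
Second derivatives within `S` are symmetric since `S` lies in the closure of its interior. -/
theorem contDiffOn_succ_postcomp (hS : UniqueDiffOn ℝ S) (hSi : S ⊆ closure (interior S))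
    (hconv : ∀ x ∈ S, ∃ r > 0, Convex ℝ (S ∩ Metric.ball x r)) {n : ℕ} (hφ : ContDiffOn ℝ 2 φ S)
    (h : ContDiffOn ℝ n (postcomp (fderivWithin ℝ φ S) : BV a b E → BV a b (E →L[ℝ] F))
      (inside a b S)) :
    ContDiffOn ℝ (n + 1 : ℕ) (postcomp φ : BV a b E → BV a b F) (inside a b S) := by
  have h1 : ContDiffOn ℝ 1 (fderivWithin ℝ φ S) S := hφ.fderivWithin hS (by norm_num)
  push_cast
  rw [contDiffOn_succ_iff_hasFDerivWithinAt (by simp)]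
  intro f hf
  rw [insert_eq_of_mem hf]
  refine ⟨inside a b S, self_mem_nhdsWithin, by simp,
    fun g => clmApply (postcomp (fderivWithin ℝ φ S) g), fun g hg => ?_,
    (clmApply (a := a) (b := b) (E := E) (F := F)).contDiff.comp_contDiffOn h⟩
  refine hasFDerivWithinAt_postcomp hconv (hφ.continuousOn_fderivWithin hS (by norm_num))
    (fun x hx => (hφ.differentiableOn (by norm_num) x hx).hasFDerivWithinAt)
    (h1.continuousOn_fderivWithin hS le_rfl)
    (fun x hx => (h1.differentiableOn one_ne_zero x hx).hasFDerivWithinAt) (fun x hx u v => ?_) hg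
  exact (hφ x hx).isSymmSndFDerivWithinAt (by simp) hS (hSi hx) hx u v

end Postcomp

universe u v

/-- The induction replaces `F` by `E →L[ℝ] F`, so `F` must range over a universe closed under this;
the general case enters it after one derivative. -/
theorem contDiffOn_postcomp_aux {a b : ℝ} [Fact (a < b)] {E : Type u} [NormedAddCommGroup E]
    [NormedSpace ℝ E] [CompleteSpace E] {S : Set E} (hS : UniqueDiffOn ℝ S)
    (hSi : S ⊆ closure (interior S))
    (hconv : ∀ x ∈ S, ∃ r > 0, Convex ℝ (S ∩ Metric.ball x r)) (n : ℕ) :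
    ∀ {F : Type (max u v)} [NormedAddCommGroup F] [NormedSpace ℝ F] [CompleteSpace F] {φ : E → F},
      ContDiffOn ℝ (n + 1 : ℕ) φ S →
      ContDiffOn ℝ n (postcomp φ : BV a b E → BV a b F) (inside a b S) := by
  induction n with
  | zero =>
    intro F _ _ _ φ hφ
    exact contDiffOn_zero_postcomp hS (by simpa using hφ)
  | succ n ih =>
    intro F _ _ _ φ hφ
    refine contDiffOn_succ_postcomp hS hSi hconv (hφ.of_le ?_) (ih (hφ.fderivWithin hS ?_))
    · exact_mod_cast (by omega : 2 ≤ n + 1 + 1)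
    · exact_mod_cast le_rfl

/-- Composition with a `C^{n+1}`-map is a `C^n`-map between spaces of `BV`-functions. -/
theorem contDiffOn_postcomp {a b : ℝ} [Fact (a < b)] {E : Type u} [NormedAddCommGroup E]
    [NormedSpace ℝ E] [CompleteSpace E] {F : Type v} [NormedAddCommGroup F] [NormedSpace ℝ F]
    [CompleteSpace F] {S : Set E} (hS : UniqueDiffOn ℝ S) (hSi : S ⊆ closure (interior S))
    (hconv : ∀ x ∈ S, ∃ r > 0, Convex ℝ (S ∩ Metric.ball x r)) {n : ℕ} {φ : E → F}
    (hφ : ContDiffOn ℝ (n + 1 : ℕ) φ S) :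
    ContDiffOn ℝ n (postcomp φ : BV a b E → BV a b F) (inside a b S) := by
  cases n with
  | zero => exact contDiffOn_zero_postcomp hS (by simpa using hφ)
  | succ n =>
    refine contDiffOn_succ_postcomp hS hSi hconv (hφ.of_le ?_)
      (contDiffOn_postcomp_aux.{u, v} hS hSi hconv n (hφ.fderivWithin hS ?_))
    · exact_mod_cast (by omega : 2 ≤ n + 1 + 1)
    · exact_mod_cast le_rfl

/-! ### The graph of a `BV`-function -/

section Graph

variable {a b : ℝ} [hab : Fact (a < b)]
  {E : Type*} [NormedAddCommGroup E] [NormedSpace ℝ E] [CompleteSpace E]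

/-- The inclusion has density 1 with respect to Lebesgue measure on [a,b]. -/
theorem coe_mem_bvFunctions : (fun t : Icc a b => (t : ℝ)) ∈ bvFunctions a b ℝ := by
  set ν : Measure (Icc a b) := Measure.comap Subtype.val volume
  have hvol : ∀ s : Set (Icc a b), ν s = volume (Subtype.val '' s) := fun s =>
    comap_subtype_coe_apply measurableSet_Icc volume s
  have hfin : IsFiniteMeasure ν := ⟨by
    rw [hvol univ, image_univ, Subtype.range_coe]; simp⟩
  have hna : NullSingletonClass ν := ⟨fun x => by
    rw [hvol {x}, image_singleton]; simp⟩
  refine mem_bvFunctions (ν := ν) (ρ := fun _ => 1) ⟨integrable_const _, fun x => ?_⟩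
  have : (Subtype.val '' Iic x : Set ℝ) = Icc a x := by
    ext y
    constructor
    · rintro ⟨z, hz, rfl⟩; exact ⟨z.2.1, hz⟩
    · rintro ⟨h1, h2⟩; exact ⟨⟨y, h1, h2.trans x.2.2⟩, h2, rfl⟩
  rw [setIntegral_const, measureReal_def, hvol (Iic x), this, Real.volume_Icc,
    ENNReal.toReal_ofReal (sub_nonneg.2 x.2.1)]
  simp [leftPt]

/-- The `BV`-function `t ↦ (t, f t)`. -/
noncomputable def graph (f : BV a b E) : BV a b (ℝ × E) :=
  mapCLM (ContinuousLinearMap.inl ℝ ℝ E) (ofMem _ coe_mem_bvFunctions) +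
    mapCLM (ContinuousLinearMap.inr ℝ ℝ E) f

@[simp] theorem graph_apply (f : BV a b E) (t : Icc a b) : graph f t = ((t : ℝ), f t) := by
  simp [graph]

theorem contDiff_graph {n : WithTop ℕ∞} : ContDiff ℝ n (graph : BV a b E → BV a b (ℝ × E)) :=
  contDiff_const.add (mapCLM (ContinuousLinearMap.inr ℝ ℝ E)).contDiff

end Graph

end BV

/-! ### Geometry of [a,b] × U and the conclusion -/

/-- In a ball whose second projection stays inside `U`, only the convex constraint from [a,b]
remains. -/
theorem exists_convex_Icc_prod_inter_ball {a b : ℝ} {E : Type*} [NormedAddCommGroup E]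
    [NormedSpace ℝ E] {U : Set E} (hU : IsOpen U) {x : ℝ × E} (hx : x ∈ Icc a b ×ˢ U) :
    ∃ r > 0, Convex ℝ (Icc a b ×ˢ U ∩ Metric.ball x r) := by
  obtain ⟨r, hr, h⟩ := Metric.isOpen_iff.1 hU x.2 hx.2
  refine ⟨r, hr, ?_⟩
  have : Icc a b ×ˢ U ∩ Metric.ball x r = (Icc a b ×ˢ univ) ∩ Metric.ball x r := by
    ext y
    simp only [mem_inter_iff, mem_prod, mem_univ, and_true, and_congr_left_iff, and_iff_left_iff_imp]
    intro hy _
    refine h ?_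
    rw [Metric.mem_ball, Prod.dist_eq] at hy
    exact (le_max_right _ _).trans_lt hy
  rw [this]
  exact ((convex_Icc a b).prod convex_univ).inter (convex_ball x r)

theorem Icc_prod_subset_closure_interior {a b : ℝ} (hab : a < b) {E : Type*}
    [NormedAddCommGroup E] {U : Set E} (hU : IsOpen U) :
    Icc a b ×ˢ U ⊆ closure (interior (Icc a b ×ˢ U)) := by
  rw [interior_prod_eq, hU.interior_eq, interior_Icc, closure_prod_eq, closure_Ioo hab.ne]
  exact prod_mono_right subset_closure

theorem BV.exists_bastianiOn_pushforward {a b : ℝ} [hab : Fact (a < b)]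
    {E F : Type*} [NormedAddCommGroup E] [NormedSpace ℝ E] [CompleteSpace E]
    [NormedAddCommGroup F] [NormedSpace ℝ F] [CompleteSpace F]
    {U : Set E} (hU : IsOpen U) {φ : ℝ × E → F} {k : ℕ∞}
    (hφ : BastianiOn (k + 2) φ (Icc a b ×ˢ U)) :
    ∃ φstar : BV a b E → BV a b F,
      (∀ f ∈ BV.inside a b U, ∀ t : Icc a b, φstar f t = φ (t, f t)) ∧
      BastianiOn k φstar (BV.inside a b U) := by
  have hS : UniqueDiffOn ℝ (Icc a b ×ˢ U) := (uniqueDiffOn_Icc hab.out).prod hU.uniqueDiffOn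
  have hSi := Icc_prod_subset_closure_interior hab.out hU
  -- Bastiani order n + 2 gives Fréchet order n + 1. Working with finite n ≤ k also covers k = ∞.
  have hC : ∀ n : ℕ, (n : ℕ∞) ≤ k → ContDiffOn ℝ (n + 1 : ℕ) φ (Icc a b ×ˢ U) := fun n hn =>
    (hφ.mono (by push_cast; rw [add_assoc, one_add_one_eq_two]; gcongr)).contDiffOn hSi
      fun x hx => exists_convex_Icc_prod_inter_ball hU hx
  have hmaps : ∀ f ∈ inside a b U, graph f ∈ inside a b (Icc a b ×ˢ U) := fun f hf t => by
    rw [graph_apply]; exact ⟨t.2, hf t⟩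
  have hC1 : ContDiffOn ℝ 1 φ (Icc a b ×ˢ U) := by simpa using hC 0 (by simp)
  refine ⟨fun f => postcomp φ (graph f), fun f hf t => ?_,
    ContDiffOn.bastianiOn (isOpen_inside hU) (contDiffOn_iff_forall_nat_le.2 fun n hn => ?_)⟩
  · rw [postcomp_apply (hC1.continuousOn_fderivWithin hS le_rfl)
      (fun x hx => (hC1.differentiableOn one_ne_zero x hx).hasFDerivWithinAt) (hmaps f hf),
      graph_apply]
  · exact (contDiffOn_postcomp hS hSi (fun x hx => exists_convex_Icc_prod_inter_ball hU hx)
      (hC n hn)).comp contDiff_graph.contDiffOn hmaps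

theorem mainTheorem8 {a b : ℝ} [Fact (a < b)]
    {E F : Type*} [NormedAddCommGroup E] [NormedSpace ℝ E] [CompleteSpace E]
    [NormedAddCommGroup F] [NormedSpace ℝ F] [CompleteSpace F]
    (U : Set E) (hU : IsOpen U) (φ : ℝ × E → F) :
    IsOpen (BV.inside a b U) ∧
    (∀ k : ℕ∞, BastianiOn (k + 2) φ (Icc a b ×ˢ U) →
      ∃ φstar : BV a b E → BV a b F,
        (∀ f ∈ BV.inside a b U, ∀ t : Icc a b, φstar f t = φ (t, f t)) ∧
        BastianiOn k φstar (BV.inside a b U)) ∧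
    (BastianiOn ⊤ φ (Icc a b ×ˢ U) →
      ∃ φstar : BV a b E → BV a b F,
        (∀ f ∈ BV.inside a b U, ∀ t : Icc a b, φstar f t = φ (t, f t)) ∧
        BastianiOn ⊤ φstar (BV.inside a b U)) :=
  ⟨BV.isOpen_inside hU, fun _ h => BV.exists_bastianiOn_pushforward hU h,
    fun h => BV.exists_bastianiOn_pushforward hU (by simpa using h)⟩
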